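/- Let $M$ be a smooth manifold of dimension $2h+2k+2$ ($h,k\ge 0$), and let $(\alpha_1,\alpha_2)$ be a contact pair of type $(h,k)$ on $M$: $\alpha_1,\alpha_2$ are smooth $1$-forms such that $\alpha_1\wedge(d\alpha_1)^h\wedge\alpha_2\wedge(d\alpha_2)^k$ is a volume form, $(d\alpha_1)^{h+1}=0$ and $(d\alpha_2)^{k+1}=0$. Let $Z_1,Z_2$ be its Reeb vector fields, i.e. the vector fields determined by $\alpha_i(Z_j)=\delta_{ij}$ and $i_{Z_j}d\alpha_i=0$ for $i,j\in\{1,2\}$. Let $\phi$ be a smooth field of endomorphisms of $TM$ with $\phi^2=-\mathrm{Id}+\alpha_1\otimes Z_1+\alpha_2\otimes Z_2$ and $\phi(Z_1)=\phi(Z_2)=0$. For $i=1,2$ let $\mathcal F_i$ be the characteristic foliation of $\alpha_i$, with $T\mathcal F_i=\ker\alpha_i\cap\ker d\alpha_i$, where $\ker d\alpha_i=\{v: d\alpha_i(v,\cdot)=0\}$. Assume that $\phi$ is decomposable, i.e. $\phi(T\mathcal F_i)\subset T\mathcal F_i$ for $i=1,2$. Then $(\alpha_1,Z_1,\phi)$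 (resp. $(\alpha_2,Z_2,\phi)$) restricts to an almost contact structure on every leaf of $\mathcal F_2$ (resp. $\mathcal F_1$). Here an almost contact structure $(\alpha,Z,\phi)$ on a manifold $L$ is called normal if the almost complex structure $X+f\frac{d}{dt}\mapsto \phi X-fZ+\alpha(X)\frac{d}{dt}$ on $L\times\mathbb R$ is integrable, and an almost complex structure $A$ is called integrable if its Nijenhuis tensor $A^2[X,Y]+[AX,AY]-A[AX,Y]-A[X,AY]$ vanishes for all smooth vector fields $X,Y$. Assume that all these induced structures on the leaves of $\mathcal F_1$ and of $\mathcal F_2$ are normal (equivalently, since normality is local, that the structures induced on all connected integral manifolds of $T\mathcal F_1$ and of $T\mathcal F_2$ are normal). Then the almost complex structure $$J=\phi-\alpha_2\otimes Z_1+\alpha_1\otimes Z_2$$ on $M$ is integrable if and only if the almost complex structure $$T=\phi+\alpha_2\otimes Z_1-\alpha_1\otimes Z_2$$ is integrable. -/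

import Mathlib

open Set Bundle VectorField
open scoped Manifold ContDiff

noncomputable section

namespace ContactPairs

/-! ### Exterior algebra of a vector space -/

section Algebra

variable {V : Type*} [AddCommGroup V] [Module ℝ V]

/-- The wedge product of a `p`-form and a `q`-form on a real vector space: the alternating sum
over the `(p, q)`-shuffles of the products of the values. -/
def wedge {p q : ℕ} (a : V [⋀^Fin p]→ₗ[ℝ] ℝ) (b : V [⋀^Fin q]→ₗ[ℝ] ℝ) :
    V [⋀^Fin (p + q)]→ₗ[ℝ] ℝ :=
  ((LinearMap.mul' ℝ ℝ).compAlternatingMap (a.domCoprod b)).domDomCongr finSumFinEquiv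

/-- The `n`-th wedge power of a two-form; the `0`-th power is the constant `1`. -/
def wedgePow (b : V [⋀^Fin 2]→ₗ[ℝ] ℝ) : (n : ℕ) → V [⋀^Fin (2 * n)]→ₗ[ℝ] ℝ
  | 0 => AlternatingMap.constOfIsEmpty ℝ V (Fin 0) (1 : ℝ)
  | n + 1 => wedge (wedgePow b n) b

/-- A linear form, seen as an alternating form of degree one. -/
def oneForm (a : V →ₗ[ℝ] ℝ) : V [⋀^Fin 1]→ₗ[ℝ] ℝ :=
  AlternatingMap.ofSubsingleton ℝ V ℝ (0 : Fin 1) a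

end Algebra

/-! ### Tensor fields on a manifold -/

section Manifold

variable {E : Type*} [NormedAddCommGroup E] [NormedSpace ℝ E]
  {H : Type*} [TopologicalSpace H] (I : ModelWithCorners ℝ E H)
  {M : Type*} [TopologicalSpace M] [ChartedSpace H M]

/-- Smoothness of a vector field. -/
def SmoothVectorField [IsManifold I 1 M] (X : Π x : M, TangentSpace I x) : Prop :=
  ContMDiff I I.tangent ∞ (fun x => (⟨x, X x⟩ : TangentBundle I M))

/-- Smoothness of a one-form, as a section of the cotangent bundle. -/
def SmoothOneForm [IsManifold I 1 M] (α : Π x : M, TangentSpace I x →L[ℝ] ℝ) : Prop :=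
  ContMDiff I (I.prod 𝓘(ℝ, E →L[ℝ] ℝ)) ∞
    (fun x => TotalSpace.mk' (E →L[ℝ] ℝ)
      (E := fun x : M => TangentSpace I x →L[ℝ] Trivial M ℝ x) x (α x))

/-- Smoothness of a tensor field of type `(1,1)`, as a section of the endomorphism bundle. -/
def SmoothEndomorphismField [IsManifold I 1 M]
    (A : Π x : M, TangentSpace I x →L[ℝ] TangentSpace I x) : Prop :=
  ContMDiff I (I.prod 𝓘(ℝ, E →L[ℝ] E)) ∞
    (fun x => TotalSpace.mk' (E →L[ℝ] E)
      (E := fun x : M => TangentSpace I x →L[ℝ] TangentSpace I x) x (A x))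

/-- The local expression of a one-form in the preferred chart at `x₀`: its pullback to the model
vector space by the inverse of the chart. -/
def localOneForm (α : Π x : M, TangentSpace I x →L[ℝ] ℝ) (x₀ : M) :
    E → E [⋀^Fin 1]→L[ℝ] ℝ := fun y =>
  ContinuousAlternatingMap.ofSubsingleton ℝ E ℝ (0 : Fin 1)
    ((α ((extChartAt I x₀).symm y)).comp
      (mfderivWithin 𝓘(ℝ, E) I (extChartAt I x₀).symm (range I) y))

/-- The exterior derivative of a one-form: take the exterior derivative of the local expression in
the preferred chart at `x` and pull it back by the chart. -/
def extDerivOneForm (α : Π x : M, TangentSpace I x →L[ℝ] ℝ) (x : M) :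
    TangentSpace I x [⋀^Fin 2]→L[ℝ] ℝ :=
  (extDerivWithin (localOneForm I α x) (range I) (extChartAt I x x)).compContinuousLinearMap
    (mfderiv I 𝓘(ℝ, E) (extChartAt I x) x : TangentSpace I x →L[ℝ] E)

/-- The Nijenhuis tensor `[A, A](X, Y) = A² [X, Y] + [A X, A Y] - A [A X, Y] - A [X, A Y]`. -/
def nijenhuis (A : Π x : M, TangentSpace I x →L[ℝ] TangentSpace I x)
    (X Y : Π x : M, TangentSpace I x) (x : M) : TangentSpace I x :=
  A x (A x (mlieBracket I X Y x))
    + mlieBracket I (fun y => A y (X y)) (fun y => A y (Y y)) x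
    - A x (mlieBracket I (fun y => A y (X y)) Y x)
    - A x (mlieBracket I X (fun y => A y (Y y)) x)

/-- Integrability of an almost complex structure: its Nijenhuis tensor vanishes identically. -/
def IsIntegrable [IsManifold I 1 M] (A : Π x : M, TangentSpace I x →L[ℝ] TangentSpace I x) :
    Prop :=
  ∀ X Y : Π x : M, TangentSpace I x, SmoothVectorField I X → SmoothVectorField I Y →
    ∀ x, nijenhuis I A X Y x = 0

/-! ### Almost contact structures -/

/-- The almost complex structure on `M × ℝ` attached to an almost contact structure `(α, Z, φ)` on
`M`, namely `J (X + f d/dt) = φ X - f Z + α(X) d/dt`. The tangent space of `M × ℝ` at `(x, t)` is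
`T_x M × ℝ`. -/
def productComplexStructure (α : Π x : M, TangentSpace I x →L[ℝ] ℝ) (Z : Π x : M, TangentSpace I x)
    (φ : Π x : M, TangentSpace I x →L[ℝ] TangentSpace I x) (p : M × ℝ) :
    TangentSpace (I.prod 𝓘(ℝ, ℝ)) p →L[ℝ] TangentSpace (I.prod 𝓘(ℝ, ℝ)) p :=
  (((φ p.1).comp (ContinuousLinearMap.fst ℝ (TangentSpace I p.1) ℝ)
      - (ContinuousLinearMap.snd ℝ (TangentSpace I p.1) ℝ).smulRight (Z p.1)).prod
    ((α p.1).comp (ContinuousLinearMap.fst ℝ (TangentSpace I p.1) ℝ)) :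
    TangentSpace I p.1 × ℝ →L[ℝ] TangentSpace I p.1 × ℝ)

/-- Normality of an almost contact structure `(α, Z, φ)` on `M`: the associated almost complex
structure on `M × ℝ` is integrable. -/
def IsNormal [IsManifold (I.prod 𝓘(ℝ, ℝ)) 1 (M × ℝ)]
    (α : Π x : M, TangentSpace I x →L[ℝ] ℝ) (Z : Π x : M, TangentSpace I x)
    (φ : Π x : M, TangentSpace I x →L[ℝ] TangentSpace I x) : Prop :=
  IsIntegrable (I.prod 𝓘(ℝ, ℝ)) (productComplexStructure I α Z φ)

/-! ### Contact pairs -/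

/-- `(α₁, α₂)` is a contact pair of type `(h, k)` on the `(2h+2k+2)`-dimensional manifold `M`. -/
structure IsContactPair [IsManifold I 1 M] (h k : ℕ)
    (α₁ α₂ : Π x : M, TangentSpace I x →L[ℝ] ℝ) : Prop where
  finrank_eq : Module.finrank ℝ E = 2 * h + 2 * k + 2
  smooth₁ : SmoothOneForm I α₁
  smooth₂ : SmoothOneForm I α₂
  /-- `α₁ ∧ (dα₁)^h ∧ α₂ ∧ (dα₂)^k` is a volume form. -/
  volume_form : ∀ x,
    wedge
      (wedge
        (wedge (oneForm (α₁ x).toLinearMap)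
          (wedgePow (extDerivOneForm I α₁ x).toAlternatingMap h))
        (oneForm (α₂ x).toLinearMap))
      (wedgePow (extDerivOneForm I α₂ x).toAlternatingMap k) ≠ 0
  pow₁_eq_zero : ∀ x, wedgePow (extDerivOneForm I α₁ x).toAlternatingMap (h + 1) = 0
  pow₂_eq_zero : ∀ x, wedgePow (extDerivOneForm I α₂ x).toAlternatingMap (k + 1) = 0

/-- `Z₁` and `Z₂` are the Reeb vector fields of the contact pair `(α₁, α₂)`. -/
structure IsReebPair [IsManifold I 1 M] (α₁ α₂ : Π x : M, TangentSpace I x →L[ℝ] ℝ)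
    (Z₁ Z₂ : Π x : M, TangentSpace I x) : Prop where
  smooth₁ : SmoothVectorField I Z₁
  smooth₂ : SmoothVectorField I Z₂
  apply₁₁ : ∀ x, α₁ x (Z₁ x) = 1
  apply₂₂ : ∀ x, α₂ x (Z₂ x) = 1
  apply₁₂ : ∀ x, α₁ x (Z₂ x) = 0
  apply₂₁ : ∀ x, α₂ x (Z₁ x) = 0
  contract₁₁ : ∀ x v, extDerivOneForm I α₁ x ![Z₁ x, v] = 0
  contract₁₂ : ∀ x v, extDerivOneForm I α₂ x ![Z₁ x, v] = 0
  contract₂₁ : ∀ x v, extDerivOneForm I α₁ x ![Z₂ x, v] = 0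
  contract₂₂ : ∀ x v, extDerivOneForm I α₂ x ![Z₂ x, v] = 0

/-- `(α₁, α₂, φ)` is a contact pair structure of type `(h, k)` with Reeb vector fields
`Z₁`, `Z₂`. -/
structure IsContactPairStructure [IsManifold I 1 M] (h k : ℕ)
    (α₁ α₂ : Π x : M, TangentSpace I x →L[ℝ] ℝ) (Z₁ Z₂ : Π x : M, TangentSpace I x)
    (φ : Π x : M, TangentSpace I x →L[ℝ] TangentSpace I x) : Prop where
  contactPair : IsContactPair I h k α₁ α₂
  reeb : IsReebPair I α₁ α₂ Z₁ Z₂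
  smooth : SmoothEndomorphismField I φ
  sq : ∀ x v, φ x (φ x v) = -v + α₁ x v • Z₁ x + α₂ x v • Z₂ x
  apply_reeb₁ : ∀ x, φ x (Z₁ x) = 0
  apply_reeb₂ : ∀ x, φ x (Z₂ x) = 0

/-- The characteristic distribution `ker α ∩ ker dα` of a one-form, that is, the tangent bundle of
its characteristic foliation. -/
def characteristic (α : Π x : M, TangentSpace I x →L[ℝ] ℝ) (x : M) :
    Submodule ℝ (TangentSpace I x) where
  carrier := {v | α x v = 0 ∧ ∀ w, extDerivOneForm I α x ![v, w] = 0}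
  zero_mem' := ⟨map_zero _, fun w =>
    (extDerivOneForm I α x).map_coord_zero (0 : Fin 2) (by simp)⟩
  add_mem' := by
    rintro a b ⟨ha, ha'⟩ ⟨hb, hb'⟩
    refine ⟨by rw [map_add, ha, hb, add_zero], fun w => ?_⟩
    have h := (extDerivOneForm I α x).map_update_add ![a, w] (0 : Fin 2) a b
    have e : ∀ u, Function.update ![a, w] (0 : Fin 2) u = ![u, w] := fun u => by
      funext i; fin_cases i <;> rfl
    rw [e, e, e, ha' w, hb' w, add_zero] at h
    exact h
  smul_mem' := by
    rintro c a ⟨ha, ha'⟩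
    refine ⟨by rw [map_smul, ha, smul_zero], fun w => ?_⟩
    have h := (extDerivOneForm I α x).map_update_smul ![a, w] (0 : Fin 2) c a
    have e : ∀ u, Function.update ![a, w] (0 : Fin 2) u = ![u, w] := fun u => by
      funext i; fin_cases i <;> rfl
    rw [e, e, ha' w, smul_zero] at h
    exact h

/-- `φ` is decomposable: it preserves the tangent bundles of both characteristic foliations. -/
def IsDecomposable (α₁ α₂ : Π x : M, TangentSpace I x →L[ℝ] ℝ)
    (φ : Π x : M, TangentSpace I x →L[ℝ] TangentSpace I x) : Prop :=
  (∀ x, ∀ v ∈ characteristic I α₁ x, φ x v ∈ characteristic I α₁ x) ∧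
    ∀ x, ∀ v ∈ characteristic I α₂ x, φ x v ∈ characteristic I α₂ x

/-- The almost complex structure `J = φ - α₂ ⊗ Z₁ + α₁ ⊗ Z₂`. -/
def almostComplexJ (α₁ α₂ : Π x : M, TangentSpace I x →L[ℝ] ℝ)
    (Z₁ Z₂ : Π x : M, TangentSpace I x)
    (φ : Π x : M, TangentSpace I x →L[ℝ] TangentSpace I x) (x : M) :
    TangentSpace I x →L[ℝ] TangentSpace I x :=
  φ x - (α₂ x).smulRight (Z₁ x) + (α₁ x).smulRight (Z₂ x)

/-- The almost complex structure `T = φ + α₂ ⊗ Z₁ - α₁ ⊗ Z₂`. -/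
def almostComplexT (α₁ α₂ : Π x : M, TangentSpace I x →L[ℝ] ℝ)
    (Z₁ Z₂ : Π x : M, TangentSpace I x)
    (φ : Π x : M, TangentSpace I x →L[ℝ] TangentSpace I x) (x : M) :
    TangentSpace I x →L[ℝ] TangentSpace I x :=
  φ x + (α₂ x).smulRight (Z₁ x) - (α₁ x).smulRight (Z₂ x)

/-! ### Leaves and induced structures -/

/-- `ι : L → M` is an integral manifold of the distribution `D`: a smooth injective immersion whose
tangent spaces are exactly the spaces of `D`. -/
structure IsIntegralManifold {E' : Type*} [NormedAddCommGroup E'] [NormedSpace ℝ E']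
    {H' : Type*} [TopologicalSpace H'] (I' : ModelWithCorners ℝ E' H')
    {L : Type*} [TopologicalSpace L] [ChartedSpace H' L]
    (D : Π x : M, Submodule ℝ (TangentSpace I x)) (ι : L → M) : Prop where
  smooth : ContMDiff I' I ∞ ι
  injective : Function.Injective ι
  immersion : ∀ p, Function.Injective (mfderiv I' I ι p)
  tangent : ∀ p, LinearMap.range (mfderiv I' I ι p).toLinearMap = D (ι p)

/-- The structures that `(α, Z, φ)` induces on the leaves of the foliation with tangent bundle `D`
are normal.

The one-form induced on `ι : L → M` is the pullback of `α`; the induced vector field `Z'` and the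
induced endomorphism field `φ'` are the ones that correspond to `Z` and to the restriction of `φ`
under the differential of `ι`, which determines them uniquely. All connected integral manifolds `L`
of `D` are considered: these are the leaves and their connected open subsets (with their leaf
topology), and normality is a local property. A connected second countable manifold has at most the
cardinality of the continuum, so that it is no restriction to take `L` in the lowest universe. -/
def LeavesAreNormal (D : Π x : M, Submodule ℝ (TangentSpace I x))
    (α : Π x : M, TangentSpace I x →L[ℝ] ℝ) (Z : Π x : M, TangentSpace I x)
    (φ : Π x : M, TangentSpace I x →L[ℝ] TangentSpace I x) : Prop :=
  ∀ (m : ℕ) (L : Type) [TopologicalSpace L] [ChartedSpace (EuclideanSpace ℝ (Fin m)) L]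
    [IsManifold (𝓡 m) ∞ L] [T2Space L] [SecondCountableTopology L] [ConnectedSpace L]
    (ι : L → M), IsIntegralManifold I (𝓡 m) D ι →
    ∀ (Z' : Π p : L, TangentSpace (𝓡 m) p)
      (φ' : Π p : L, TangentSpace (𝓡 m) p →L[ℝ] TangentSpace (𝓡 m) p),
      (∀ p, mfderiv (𝓡 m) I ι p (Z' p) = Z (ι p)) →
      (∀ p v, mfderiv (𝓡 m) I ι p (φ' p v) = φ (ι p) (mfderiv (𝓡 m) I ι p v)) →
      IsNormal (𝓡 m) (fun p => (α (ι p)).comp (mfderiv (𝓡 m) I ι p)) Z' φ'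

end Manifold

end ContactPairs

end

/-! ### Total differential equations: the Frobenius theorem in a Banach space. -/

noncomputable section

open Metric Filter Topology
open scoped NNReal

namespace ContactPairs

/-! Both structures have the form A = φ + ε (α₁ ⊗ Z₂ - α₂ ⊗ Z₁), with ε = 1 for J and ε = -1 for T,
so the question is how the Nijenhuis tensor N of A depends on the sign of ε. N is tensorial and
involves only first derivatives, hence everything reduces to algebra with the 1-jet of the data at a
point (`ContactJet`, where the index `false` stands for 1 and `true` for 2).

Let Lᵢ be minus the Lie derivative of φ along Zᵢ, and call v horizontal if α₁(v) = α₂(v) = 0. Since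
ε² = 1, for horizontal v one finds N(Z₁, Z₂) = 0, N(v, Z₁) = -φ L₁v + ε L₂v and N(v, Z₂) = -φ L₂v -
ε L₁v. On two horizontal vectors N is independent of ε up to terms ± ε (dαᵢ(φv, w) + dαᵢ(v, φw)).

Normality along the leaves of F₂ yields that L₁ and the defect dα₁(φv, w) + dα₁(v, φw) vanish on
TF₂; the leaves of F₁ give the same for the index 2 on TF₁. The defect of dαᵢ also vanishes as soon
as one argument lies in TFᵢ, because φ preserves TFᵢ ⊆ ker dαᵢ. As TM = TF₁ ⊕ TF₂, both defects
vanish on horizontal vectors. If A is integrable, then for horizontal v₁ in TF₁ the equation 0 =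
N(v₁, Z₂) reads ε L₁v₁ = 0; so L₁, and likewise L₂, vanishes on all horizontal vectors. What remains
of N does not see ε (`ContactJet.IsContact.nijenhuisJet_cpx_neg_eq_zero`).

Two inputs feed this algebra. The splitting and the constant ranks of TF₁ and TF₂ are linear algebra
of the volume form (`isCompl_of_wedge_ne_zero`). The normality hypothesis speaks of integral
manifolds, so one must be produced through every point (`exists_hasFDerivAt_eq`,
`exists_integral_immersion_localCharacteristic`); normality on it is then turned into identities
between ambient derivatives (`IsNormal.jets`, `IsNormal.ambient_jets`,
`LeavesAreNormal.local_jets`). -/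

theorem exists_hasDerivWithinAt_mem_closedBall {E : Type*} [NormedAddCommGroup E] [NormedSpace ℝ E]
    [CompleteSpace E] {v : E → E} {y₀ : E} {a L K : ℝ≥0}
    (hb : ∀ x ∈ closedBall y₀ a, ‖v x‖ ≤ L) (hl : LipschitzOnWith K v (closedBall y₀ a))
    (hm : L ≤ a) :
    ∃ g : ℝ → E, g 0 = y₀ ∧ (∀ t ∈ Icc (0 : ℝ) 1, HasDerivWithinAt g (v (g t)) (Icc 0 1) t) ∧
      ∀ t, g t ∈ closedBall y₀ a := by
  have hf : IsPicardLindelof (fun _ ↦ v) (⟨0, by simp⟩ : Icc (0 : ℝ) 1) y₀ a 0 L K :=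
    IsPicardLindelof.of_time_independent hb hl (by simpa using hm)
  have hx : y₀ ∈ closedBall y₀ ((0 : ℝ≥0) : ℝ) := by simp
  -- The fixed point of the Picard operator is kept, rather than just a solution, because its
  -- extension by projection stays in the ball at all times.
  obtain ⟨α, hα⟩ := ODE.FunSpace.exists_isFixedPt_next hf hx
  refine ⟨α.compProj, ?_, fun t ht ↦ ?_, fun t ↦ α.compProj_mem_closedBall hf.mul_max_le⟩
  · rw [ODE.FunSpace.compProj_val (t := (⟨0, by simp⟩ : Icc (0 : ℝ) 1)), ← hα,
      ODE.FunSpace.next_apply₀]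
  · apply ODE.hasDerivWithinAt_picard_Icc (⟨0, by simp⟩ : Icc (0 : ℝ) 1).2 hf.continuousOn_uncurry
      α.continuous_compProj.continuousOn (fun _ _ ↦ α.compProj_mem_closedBall hf.mul_max_le)
      y₀ ht |>.congr_of_mem _ ht
    intro t' ht'
    nth_rw 1 [← hα]
    rw [ODE.FunSpace.compProj_of_mem ht', ODE.FunSpace.next_apply]

/-- The Taylor remainder is quadratic, uniformly in both points, because the derivative is Lipschitz
near `y₀` and balls are convex. The added `1`s only make the constants positive. -/
theorem exists_closedBall_taylor_bound {E G : Type*} [NormedAddCommGroup E] [NormedSpace ℝ E]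
    [NormedAddCommGroup G] [NormedSpace ℝ G] {s : E → G} {y₀ : E} (hs : ContDiffAt ℝ 2 s y₀) :
    ∃ a > 0, ∃ K : ℝ≥0, ∃ M > 0, ∃ N > 0, ∃ C > 0,
      (∀ y ∈ closedBall y₀ a, HasFDerivAt s (fderiv ℝ s y) y) ∧
      LipschitzOnWith K s (closedBall y₀ a) ∧
      (∀ y ∈ closedBall y₀ a, ‖s y‖ ≤ M) ∧ (∀ y ∈ closedBall y₀ a, ‖fderiv ℝ s y‖ ≤ N) ∧
      ∀ y ∈ closedBall y₀ a, ∀ z ∈ closedBall y₀ a,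
        ‖s z - s y - fderiv ℝ s y (z - y)‖ ≤ C * ‖z - y‖ ^ 2 := by
  have h1 : ContDiffAt ℝ 1 (fderiv ℝ s) y₀ := hs.fderiv_right (by norm_num)
  obtain ⟨K, S, hS, hK⟩ := (hs.of_le (by norm_num : (1 : WithTop ℕ∞) ≤ 2)).exists_lipschitzOnWith
  obtain ⟨K', S', hS', hK'⟩ := h1.exists_lipschitzOnWith
  have hd : ∀ᶠ y in 𝓝 y₀, DifferentiableAt ℝ s y := by
    filter_upwards [hs.eventually (by simp)] with y hy
    exact hy.differentiableAt (by norm_num)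
  have hM : ∀ᶠ y in 𝓝 y₀, ‖s y‖ < ‖s y₀‖ + 1 :=
    hs.continuousAt.norm.eventually_lt_const (by linarith)
  have hN : ∀ᶠ y in 𝓝 y₀, ‖fderiv ℝ s y‖ < ‖fderiv ℝ s y₀‖ + 1 :=
    h1.continuousAt.norm.eventually_lt_const (by linarith)
  obtain ⟨a, ha, hball⟩ := nhds_basis_closedBall.eventually_iff.1
    (((hd.and hM).and hN).and (Filter.Eventually.and hS hS'))
  refine ⟨a, ha, K, ‖s y₀‖ + 1, by positivity, ‖fderiv ℝ s y₀‖ + 1, by positivity, K' + 1,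
    by positivity, fun y hy ↦ (hball hy).1.1.1.hasFDerivAt, hK.mono fun y hy ↦ (hball hy).2.1,
    fun y hy ↦ (hball hy).1.1.2.le, fun y hy ↦ (hball hy).1.2.le, fun y hy z hz ↦ ?_⟩
  have hseg : segment ℝ y z ⊆ closedBall y₀ a := (convex_closedBall y₀ a).segment_subset hy hz
  have key := (convex_segment (𝕜 := ℝ) y z).norm_image_sub_le_of_norm_hasFDerivWithin_le'
    (f := s) (f' := fderiv ℝ s) (φ := fderiv ℝ s y) (C := (K' + 1) * ‖z - y‖)
    (fun w hw ↦ (hball (hseg hw)).1.1.1.hasFDerivAt.hasFDerivWithinAt)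
    (fun w hw ↦ ?_) (left_mem_segment ℝ y z) (right_mem_segment ℝ y z)
  · calc _ ≤ _ := key
      _ = _ := by ring
  · have h2 := hK'.dist_le_mul w (hball (hseg hw)).2.2 y (hball hy).2.2
    rw [dist_eq_norm, dist_eq_norm] at h2
    have h3 : ‖w - y‖ ≤ ‖z - y‖ := by
      have := norm_sub_le_of_mem_segment hw
      simpa [norm_sub_rev] using this
    calc _ ≤ _ := h2
      _ ≤ (K' + 1) * ‖z - y‖ := by gcongr; linarith

/-- The Frobenius theorem for a total differential equation `Df(x) = s(f(x))`. -/
theorem exists_hasFDerivAt_eq {E F : Type*} [NormedAddCommGroup E] [NormedSpace ℝ E]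
    [CompleteSpace E] [NormedAddCommGroup F] [NormedSpace ℝ F] {s : E → F →L[ℝ] E} {y₀ : E}
    (hs : ContDiffAt ℝ 2 s y₀)
    (hsym : ∀ᶠ y in 𝓝 y₀, ∀ u w, fderiv ℝ s y (s y u) w = fderiv ℝ s y (s y w) u)
    {V : Set E} (hV : V ∈ 𝓝 y₀) :
    ∃ r > 0, ∃ f : F → E, f 0 = y₀ ∧ ∀ x ∈ ball (0 : F) r, f x ∈ V ∧ HasFDerivAt f (s (f x)) x := by
  obtain ⟨a₁, ha₁, K, M, hM0, N, hN0, C, hC0, hd, hK, hM, hN, hC⟩ :=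
    exists_closedBall_taylor_bound hs
  obtain ⟨a₂, ha₂, hball⟩ := nhds_basis_closedBall.eventually_iff.1 (hsym.and hV)
  obtain ⟨a, ha, haa₁, haa₂⟩ : ∃ a > 0, a ≤ a₁ ∧ a ≤ a₂ :=
    ⟨min a₁ a₂, lt_min ha₁ ha₂, min_le_left _ _, min_le_right _ _⟩
  have hB₁ := closedBall_subset_closedBall (x := y₀) haa₁
  have hB₂ := closedBall_subset_closedBall (x := y₀) haa₂
  -- Up to time 1 the trajectories with direction in the ball of radius `r` move by at most `a / 2`;
  -- the other half of `a` is left for the perturbation `t • s (g x t) v` below.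
  set r := a / 2 / M with hr
  have hr0 : 0 < r := by positivity
  have hMr : M * r = a / 2 := by rw [hr]; field_simp
  have hlip : ∀ x ∈ ball (0 : F) r,
      LipschitzOnWith (K * r.toNNReal) (fun y ↦ s y x) (closedBall y₀ a) := by
    intro x hx
    rw [mem_ball_zero_iff] at hx
    refine LipschitzOnWith.of_dist_le_mul fun y hy z hz ↦ ?_
    rw [dist_eq_norm, dist_eq_norm, ← _root_.sub_apply]
    have := hK.dist_le_mul y (hB₁ hy) z (hB₁ hz)
    rw [dist_eq_norm, dist_eq_norm] at this
    calc _ ≤ ‖s y - s z‖ * ‖x‖ := ContinuousLinearMap.le_opNorm _ _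
      _ ≤ (K * ‖y - z‖) * r := by gcongr
      _ = _ := by rw [NNReal.coe_mul, Real.coe_toNNReal r hr0.le]; ring
  have hsol : ∀ x ∈ ball (0 : F) r, ∃ g : ℝ → E, g 0 = y₀ ∧
      (∀ t ∈ Icc (0 : ℝ) 1, HasDerivWithinAt g (s (g t) x) (Icc 0 1) t) ∧
      ∀ t, g t ∈ closedBall y₀ (a / 2) := by
    intro x hx
    have ha2 : (0 : ℝ) ≤ a / 2 := by positivity
    refine exists_hasDerivWithinAt_mem_closedBall (v := fun y ↦ s y x) (a := ⟨a / 2, ha2⟩)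
      (L := ⟨a / 2, ha2⟩) (K := K * r.toNNReal) (fun y hy ↦ ?_)
      ((hlip x hx).mono (closedBall_subset_closedBall ?_)) le_rfl
    · rw [mem_ball_zero_iff] at hx
      have hy' : y ∈ closedBall y₀ a :=
        closedBall_subset_closedBall (by change a / 2 ≤ a; linarith) hy
      calc ‖s y x‖ ≤ ‖s y‖ * ‖x‖ := ContinuousLinearMap.le_opNorm _ _
        _ ≤ M * r := by
          gcongr
          exact hM y (hB₁ hy')
        _ = a / 2 := hMr
    · change a / 2 ≤ a; linarith
  choose! g hg0 hg hgb using hsol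
  have hsub : closedBall y₀ (a / 2) ⊆ closedBall y₀ a := closedBall_subset_closedBall (by linarith)
  -- The value of the solution at `x` is obtained by integrating along the ray through `x` up to
  -- time 1.
  refine ⟨r, hr0, fun x ↦ g x 1, ?_, fun x hx ↦ ⟨(hball (hB₂ (hsub (hgb x hx 1)))).2, ?_⟩⟩
  · have h0 : (0 : F) ∈ ball (0 : F) r := by simpa using hr0
    have hconst : ∀ t ∈ Icc (0 : ℝ) 1, g 0 t = g 0 0 := by
      refine constant_of_derivWithin_zero (fun t ht ↦ (hg 0 h0 t ht).differentiableWithinAt)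
        fun t ht ↦ ?_
      rw [(hg 0 h0 t (Ico_subset_Icc_self ht)).derivWithin
        ((uniqueDiffOn_Icc zero_lt_one) t (Ico_subset_Icc_self ht)), map_zero]
    change g 0 1 = y₀
    rw [hconst 1 (by simp), hg0 0 h0]
  -- The `+ 1` makes the constant nonzero, so that the exponential form of the Gronwall bound
  -- applies.
  set κ : ℝ≥0 := K * r.toNNReal + 1 with hκ
  have hκ0 : (κ : ℝ) ≠ 0 := by rw [hκ]; positivity
  set D := (N * M + C * M ^ 2 * r) with hD
  -- The curve `g x t + t • s (g x t) v` solves the equation of direction `x + v` up to an error of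
  -- order `‖v‖ ^ 2`. Gronwall's inequality then bounds its distance at time 1 to the true solution.
  have main : ∀ v : F, x + v ∈ ball (0 : F) r → M * ‖v‖ ≤ a / 2 →
      ‖g (x + v) 1 - g x 1 - s (g x 1) v‖ ≤ D / κ * (Real.exp κ - 1) * ‖v‖ ^ 2 := by
    intro v hxv hv
    have hgm : ∀ t, g x t ∈ closedBall y₀ a := fun t ↦ hsub (hgb x hx t)
    have hk : ∀ t ∈ Icc (0 : ℝ) 1, ‖t • s (g x t) v‖ ≤ M * ‖v‖ := by
      intro t ht
      rw [norm_smul, Real.norm_eq_abs, abs_of_nonneg ht.1]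
      calc t * ‖s (g x t) v‖ ≤ 1 * (M * ‖v‖) := by
            gcongr
            · exact ht.2
            · exact (ContinuousLinearMap.le_opNorm _ _).trans
                (by gcongr; exact hM _ (hB₁ (hgm t)))
        _ = _ := one_mul _
    have hhm : ∀ t ∈ Icc (0 : ℝ) 1, g x t + t • s (g x t) v ∈ closedBall y₀ a := by
      intro t ht
      have h1 := hgb x hx t
      rw [mem_closedBall_iff_norm] at h1 ⊢
      calc _ = ‖(g x t - y₀) + t • s (g x t) v‖ := by congr 1; abel
        _ ≤ _ := norm_add_le _ _
        _ ≤ a / 2 + a / 2 := add_le_add h1 ((hk t ht).trans hv)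
        _ = a := by ring
    have hder : ∀ t ∈ Icc (0 : ℝ) 1, HasDerivWithinAt (fun t ↦ g x t + t • s (g x t) v)
        (s (g x t) x + (t • fderiv ℝ s (g x t) (s (g x t) x) v + (1 : ℝ) • s (g x t) v))
        (Icc 0 1) t := by
      intro t ht
      have h1 : HasDerivWithinAt (fun t ↦ s (g x t)) (fderiv ℝ s (g x t) (s (g x t) x))
          (Icc 0 1) t := (hd _ (hB₁ (hgm t))).comp_hasDerivWithinAt t (hg x hx t ht)
      have h2 : HasDerivWithinAt (fun t ↦ s (g x t) v) (fderiv ℝ s (g x t) (s (g x t) x) v)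
          (Icc 0 1) t := by
        simpa using h1.clm_apply (hasDerivWithinAt_const t (Icc 0 1) v)
      exact (hg x hx t ht).add ((hasDerivWithinAt_id t _).smul h2)
    have hICi : ∀ t ∈ Ico (0 : ℝ) 1, Icc (0 : ℝ) 1 ∈ 𝓝[Ici t] t := fun t ht ↦
      mem_of_superset (Icc_mem_nhdsGE ht.2) (Icc_subset_Icc_left ht.1)
    have hgron := dist_le_of_approx_trajectories_ODE_of_mem
      (v := fun _ y ↦ s y (x + v)) (s := fun _ ↦ closedBall y₀ a) (K := κ) (a := 0) (b := 1)
      (f := g (x + v)) (f' := fun t ↦ s (g (x + v) t) (x + v))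
      (g := fun t ↦ g x t + t • s (g x t) v)
      (g' := fun t ↦ s (g x t) x +
        (t • fderiv ℝ s (g x t) (s (g x t) x) v + (1 : ℝ) • s (g x t) v))
      (εf := 0) (εg := D * ‖v‖ ^ 2) (δ := 0)
      (fun t _ ↦ (hlip _ hxv).weaken (by rw [hκ]; exact le_add_of_nonneg_right zero_le_one))
      (fun t ht ↦ (hg _ hxv t ht).continuousWithinAt)
      (fun t ht ↦ (hg _ hxv t (Ico_subset_Icc_self ht)).mono_of_mem_nhdsWithin (hICi t ht))
      (fun t _ ↦ by simp) (fun t _ ↦ hsub (hgb _ hxv t))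
      (fun t ht ↦ (hder t ht).continuousWithinAt)
      (fun t ht ↦ (hder t (Ico_subset_Icc_self ht)).mono_of_mem_nhdsWithin (hICi t ht))
      (fun t ht ↦ ?_) (fun t ht ↦ hhm t (Ico_subset_Icc_self ht))
      (by simp [hg0 _ hx, hg0 _ hxv]) 1 (by simp)
    · rw [gronwallBound_of_K_ne_0 hκ0, dist_eq_norm] at hgron
      calc ‖g (x + v) 1 - g x 1 - s (g x 1) v‖
          = ‖g (x + v) 1 - (g x 1 + (1 : ℝ) • s (g x 1) v)‖ := by
            rw [one_smul, sub_add_eq_sub_sub]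
        _ ≤ _ := hgron
        _ = _ := by simp; ring
    · have ht' := Ico_subset_Icc_self ht
      set y := g x t with hy
      -- The integrability condition: it makes the terms of first order in `v` cancel.
      have hsymm := (hball (hB₂ (hgm t))).1 x v
      rw [dist_eq_norm]
      have hTay := hC y (hB₁ (hgm t)) (y + t • s y v) (hB₁ (hhm t ht'))
      rw [add_sub_cancel_left] at hTay
      set R := s (y + t • s y v) - s y - fderiv ℝ s y (t • s y v) with hR
      have hs' : s (y + t • s y v) = s y + fderiv ℝ s y (t • s y v) + R := by rw [hR]; abel
      have heq : s y x + (t • fderiv ℝ s y (s y x) v + (1 : ℝ) • s y v)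
          - s (y + t • s y v) (x + v) = -(fderiv ℝ s y (t • s y v) v) - R (x + v) := by
        rw [hs', hsymm]
        simp only [map_smul, map_add, _root_.add_apply,
          _root_.smul_apply, one_smul]
        abel
      rw [heq]
      have e1 : ‖fderiv ℝ s y (t • s y v) v‖ ≤ N * (M * ‖v‖) * ‖v‖ := by
        refine (ContinuousLinearMap.le_opNorm _ _).trans ?_
        gcongr
        refine (ContinuousLinearMap.le_opNorm _ _).trans ?_
        gcongr
        · exact hN _ (hB₁ (hgm t))
        · exact hk t ht'
      have e2 : ‖R (x + v)‖ ≤ C * (M * ‖v‖) ^ 2 * r := by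
        refine (ContinuousLinearMap.le_opNorm _ _).trans ?_
        rw [mem_ball_zero_iff] at hxv
        gcongr
        refine hTay.trans ?_
        gcongr
        exact hk t ht'
      calc _ ≤ ‖-(fderiv ℝ s y (t • s y v) v)‖ + ‖R (x + v)‖ := norm_sub_le _ _
        _ ≤ N * (M * ‖v‖) * ‖v‖ + C * (M * ‖v‖) ^ 2 * r := by rw [norm_neg]; gcongr
        _ = _ := by rw [hD]; ring
  rw [hasFDerivAt_iff_isLittleO_nhds_zero]
  have hev : ∀ᶠ v in 𝓝 (0 : F), x + v ∈ ball (0 : F) r ∧ M * ‖v‖ ≤ a / 2 := by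
    refine Filter.Eventually.and ?_ ?_
    · have : Tendsto (fun v : F ↦ x + v) (𝓝 0) (𝓝 x) := by
        have h : Continuous fun v : F ↦ x + v := by fun_prop
        simpa using h.tendsto 0
      exact this (isOpen_ball.mem_nhds hx)
    · have : Tendsto (fun v : F ↦ M * ‖v‖) (𝓝 0) (𝓝 0) := by
        have h : Continuous fun v : F ↦ M * ‖v‖ := by fun_prop
        simpa using h.tendsto 0
      exact this.eventually_le_const (by positivity)
  refine Asymptotics.IsBigO.trans_isLittleO (g := fun v : F ↦ ‖v‖ ^ 2) ?_
    (Asymptotics.isLittleO_norm_pow_id one_lt_two)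
  refine Asymptotics.IsBigO.of_bound (D / κ * (Real.exp κ - 1)) ?_
  filter_upwards [hev] with v hv
  rw [norm_pow, norm_norm]
  exact main v hv.1 hv.2

/-- A solution of a smooth total differential equation is smooth. -/
theorem contDiffOn_of_hasFDerivAt_eq {E F : Type*} [NormedAddCommGroup E] [NormedSpace ℝ E]
    [NormedAddCommGroup F] [NormedSpace ℝ F] {s : E → F →L[ℝ] E} {V : Set E}
    (hs : ContDiffOn ℝ ∞ s V) {f : F → E} {U : Set F} (hU : IsOpen U)
    (hf : ∀ x ∈ U, f x ∈ V ∧ HasFDerivAt f (s (f x)) x) : ContDiffOn ℝ ∞ f U := by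
  rw [contDiffOn_infty]
  intro n
  induction n with
  | zero =>
    exact contDiffOn_zero.2 fun x hx ↦ (hf x hx).2.continuousAt.continuousWithinAt
  | succ n ih =>
    push_cast
    -- Bootstrapping: the derivative of `f` is `s ∘ f`, which is as smooth as `f` itself.
    refine (contDiffOn_succ_iff_fderiv_of_isOpen hU).2
      ⟨fun x hx ↦ (hf x hx).2.differentiableAt.differentiableWithinAt, by simp, ?_⟩
    exact ((hs.of_le (by exact_mod_cast le_top)).comp ih fun x hx ↦ (hf x hx).1).congr
      fun x hx ↦ (hf x hx).2.fderiv

end ContactPairs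

end

/-! ### Pointwise algebra: how the Nijenhuis tensor depends on the sign of ε. -/

noncomputable section

set_option linter.unusedSimpArgs false
namespace ContactPairs

/-- The Nijenhuis tensor of an endomorphism field with value `A` and derivative `A'` at a point of
a vector space. -/
def nijenhuisJet {E : Type*} [NormedAddCommGroup E] [NormedSpace ℝ E]
    (A : E →L[ℝ] E) (A' : E →L[ℝ] E →L[ℝ] E) (v w : E) : E :=
  A' (A v) w - A' (A w) v + A (A' w v) - A (A' v w)

/-- First order data, at a point of a vector space, of two one-forms, two vector fields and an
endomorphism field. -/
structure ContactJet (E : Type*) [NormedAddCommGroup E] [NormedSpace ℝ E] where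
  a : Bool → E →L[ℝ] ℝ
  da : Bool → E →L[ℝ] E →L[ℝ] ℝ
  z : Bool → E
  dz : Bool → E →L[ℝ] E
  φ : E →L[ℝ] E
  dφ : E →L[ℝ] E →L[ℝ] E

namespace ContactJet

variable {E : Type*} [NormedAddCommGroup E] [NormedSpace ℝ E] (j : ContactJet E)

/-- The exterior derivatives of the one-forms. -/
def omega (i : Bool) (v w : E) : ℝ := j.da i v w - j.da i w v

/-- The Lie derivative of the endomorphism field along (minus) the vector fields. -/
def lieEnd (i : Bool) (v : E) : E := j.dz i (j.φ v) - j.dφ (j.z i) v - j.φ (j.dz i v)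

/-- The kernel of a one-form and of its exterior derivative. -/
def IsChar (i : Bool) (v : E) : Prop := j.a i v = 0 ∧ ∀ w, j.omega i v w = 0

/-- The almost complex structure `φ + ε (α₁ ⊗ Z₂ - α₂ ⊗ Z₁)`. -/
def cpx (ε : ℝ) : E →L[ℝ] E :=
  j.φ + ε • ((j.a false).smulRight (j.z true) - (j.a true).smulRight (j.z false))

lemma cpx_apply (ε : ℝ) (v : E) :
    j.cpx ε v = j.φ v + ε • (j.a false v • j.z true - j.a true v • j.z false) := rfl

/-- The first-order consequences of the axioms of a contact pair structure. -/
structure IsContact : Prop where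
  sq : ∀ v, j.φ (j.φ v) = -v + j.a false v • j.z false + j.a true v • j.z true
  a_z : ∀ i k, j.a i (j.z k) = if i = k then 1 else 0
  a_dz : ∀ i k u, j.a i (j.dz k u) = -j.da i u (j.z k)
  φ_z : ∀ i, j.φ (j.z i) = 0
  dφ_z : ∀ i u, j.dφ u (j.z i) = -j.φ (j.dz i u)
  a_φ : ∀ i v, j.a i (j.φ v) = 0
  a_dφ : ∀ i u v, j.a i (j.dφ u v) = -j.da i u (j.φ v)
  da_z : ∀ i k u, j.da i u (j.z k) = j.da i (j.z k) u
  φ_isChar : ∀ i v, j.IsChar i v → j.IsChar i (j.φ v)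
  exists_add : ∀ v, j.a false v = 0 → j.a true v = 0 →
    ∃ v₁ v₂, v₁ + v₂ = v ∧ j.IsChar false v₁ ∧ j.IsChar true v₂ ∧
      j.a true v₁ = 0 ∧ j.a false v₂ = 0
  normal_omega : ∀ i v w, j.IsChar (!i) v → j.IsChar (!i) w →
    j.omega i (j.φ v) w + j.omega i v (j.φ w) = 0
  normal_lieEnd : ∀ i v, j.IsChar (!i) v → j.lieEnd i v = 0

variable {j} {ε : ℝ} {J' : E →L[ℝ] E →L[ℝ] E}

/-- The derivative of the field `cpx ε`. -/
def IsCpxDeriv (j : ContactJet E) (ε : ℝ) (J' : E →L[ℝ] E →L[ℝ] E) : Prop :=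
  ∀ u v, J' u v = j.dφ u v +
    ε • (j.da false u v • j.z true + j.a false v • j.dz true u
      - j.da true u v • j.z false - j.a true v • j.dz false u)

/-- Here `cpx ε` sends Z₁ to ε Z₂ and Z₂ to -ε Z₁, so only the Lie derivatives of φ along the two
Reeb fields survive. The values of ε are substituted since ε² = 1 is needed. -/
lemma nijenhuisJet_cpx_false (h : j.IsContact) (hε : ε = 1 ∨ ε = -1) (hJ : j.IsCpxDeriv ε J')
    {v : E} (h₁ : j.a false v = 0) (h₂ : j.a true v = 0) :
    nijenhuisJet (j.cpx ε) J' v (j.z false) = -j.φ (j.lieEnd false v) + ε • j.lieEnd true v := by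
  have := h.da_z
  rcases hε with rfl | rfl <;>
  · simp only [nijenhuisJet, lieEnd, hJ _ _, cpx_apply, map_add, map_sub, map_smul, map_neg,
      _root_.add_apply, _root_.smul_apply, h.a_z, h.φ_z, h.dφ_z, h.a_dz, h.a_φ, h.a_dφ, this, h₁, h₂,
      smul_eq_mul,
      _root_.sub_apply, _root_.neg_apply, if_true, reduceCtorEq, if_false, zero_add, add_zero,
      one_smul, zero_smul, smul_zero, sub_zero, zero_sub, neg_smul, smul_neg, neg_neg]
    module

lemma nijenhuisJet_cpx_true (h : j.IsContact) (hε : ε = 1 ∨ ε = -1) (hJ : j.IsCpxDeriv ε J')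
    {v : E} (h₁ : j.a false v = 0) (h₂ : j.a true v = 0) :
    nijenhuisJet (j.cpx ε) J' v (j.z true) = -j.φ (j.lieEnd true v) - ε • j.lieEnd false v := by
  have := h.da_z
  rcases hε with rfl | rfl <;>
  · simp only [nijenhuisJet, lieEnd, hJ _ _, cpx_apply, map_add, map_sub, map_smul, map_neg,
      _root_.add_apply, _root_.smul_apply, h.a_z, h.φ_z, h.dφ_z, h.a_dz, h.a_φ, h.a_dφ, this, h₁, h₂,
      smul_eq_mul,
      _root_.sub_apply, _root_.neg_apply, if_true, reduceCtorEq, if_false, zero_add, add_zero,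
      one_smul, zero_smul, smul_zero, sub_zero, zero_sub, neg_smul, smul_neg, neg_neg]
    module

/-- This reflects the general identity N(X, AX) = 0 for an almost complex structure A, as Z₂ is up
to sign the image of Z₁. -/
lemma nijenhuisJet_cpx_false_true (h : j.IsContact) (hε : ε = 1 ∨ ε = -1) (hJ : j.IsCpxDeriv ε J') :
    nijenhuisJet (j.cpx ε) J' (j.z false) (j.z true) = 0 := by
  have hz (i) : j.da i (j.z true) (j.z false) = j.da i (j.z false) (j.z true) :=
    (h.da_z i false (j.z true))
  rcases hε with rfl | rfl <;>
  · simp only [nijenhuisJet, lieEnd, hJ _ _, cpx_apply, map_add, map_sub, map_smul, map_neg,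
      _root_.add_apply, _root_.smul_apply, h.a_z, h.φ_z, h.dφ_z, h.a_dz, h.a_φ, h.a_dφ, h.sq, hz,
      smul_eq_mul,
      _root_.sub_apply, _root_.neg_apply, if_true, reduceCtorEq, if_false, zero_add, add_zero,
      one_smul, zero_smul, smul_zero, sub_zero, zero_sub, neg_smul, smul_neg, neg_neg]
    module

/-- The terms with Zᵢ and no ε come from ε² = 1. The terms linear in ε measure the failure of φ to
be skew for dαᵢ. -/
lemma nijenhuisJet_cpx_horizontal (h : j.IsContact) (hε : ε = 1 ∨ ε = -1)
    (hJ : j.IsCpxDeriv ε J') {v w : E}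
    (hv₁ : j.a false v = 0) (hv₂ : j.a true v = 0) (hw₁ : j.a false w = 0) (hw₂ : j.a true w = 0) :
    nijenhuisJet (j.cpx ε) J' v w = nijenhuisJet j.φ j.dφ v w
      + j.omega false v w • j.z false + j.omega true v w • j.z true
      + (ε * (j.omega false (j.φ v) w + j.omega false v (j.φ w))) • j.z true
      - (ε * (j.omega true (j.φ v) w + j.omega true v (j.φ w))) • j.z false := by
  rcases hε with rfl | rfl <;>
  · simp only [nijenhuisJet, omega, hJ _ _, cpx_apply, map_add, map_sub, map_smul, map_neg,
      _root_.add_apply, _root_.smul_apply, h.a_z, h.φ_z, h.dφ_z, h.a_dz, h.a_φ, h.a_dφ, hv₁, hv₂, hw₁, hw₂,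
      smul_eq_mul,
      _root_.sub_apply, _root_.neg_apply, if_true, reduceCtorEq, if_false, zero_add, add_zero,
      one_smul, zero_smul, smul_zero, sub_zero, zero_sub, neg_smul, smul_neg, neg_neg]
    module

lemma lieEnd_add (i : Bool) (v w : E) : j.lieEnd i (v + w) = j.lieEnd i v + j.lieEnd i w := by
  simp only [lieEnd, map_add]; abel

lemma omega_add_left (i : Bool) (u v w : E) :
    j.omega i (u + v) w = j.omega i u w + j.omega i v w := by
  simp only [omega, map_add, _root_.add_apply]; abel

lemma omega_swap (i : Bool) (v w : E) : j.omega i v w = -j.omega i w v := by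
  simp only [omega]; abel

lemma omega_add_right (i : Bool) (u v w : E) :
    j.omega i u (v + w) = j.omega i u v + j.omega i u w := by
  rw [omega_swap, omega_add_left, omega_swap i v, omega_swap i w]; abel

/-- Split both arguments along the two characteristic subspaces. Whenever an argument lies in the
subspace of index `i` both terms vanish, since φ preserves that subspace; the remaining pair is
covered by normality. -/
lemma IsContact.omega_φ_add_omega_φ_eq_zero (h : j.IsContact) (i : Bool) {v w : E}
    (hv₁ : j.a false v = 0) (hv₂ : j.a true v = 0) (hw₁ : j.a false w = 0) (hw₂ : j.a true w = 0) :
    j.omega i (j.φ v) w + j.omega i v (j.φ w) = 0 := by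
  have hchar : ∀ x y, j.IsChar i x → j.omega i (j.φ x) y + j.omega i x (j.φ y) = 0 :=
    fun x y hx ↦ by rw [hx.2, (h.φ_isChar i x hx).2, add_zero]
  have hchar' : ∀ x y, j.IsChar i y → j.omega i (j.φ x) y + j.omega i x (j.φ y) = 0 :=
    fun x y hy ↦ by
      rw [omega_swap, hy.2, omega_swap, (h.φ_isChar i y hy).2, neg_zero, add_zero]
  have hsplit : ∀ x, j.a false x = 0 → j.a true x = 0 →
      ∃ x₁ x₂, x₁ + x₂ = x ∧ j.IsChar i x₁ ∧ j.IsChar (!i) x₂ := by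
    intro x hx₁ hx₂
    obtain ⟨x₁, x₂, hx, h₁, h₂, -, -⟩ := h.exists_add x hx₁ hx₂
    cases i
    · exact ⟨x₁, x₂, hx, h₁, h₂⟩
    · exact ⟨x₂, x₁, by rw [add_comm, hx], h₂, h₁⟩
  obtain ⟨v₁, v₂, rfl, hv₁, hv₂⟩ := hsplit v hv₁ hv₂
  obtain ⟨w₁, w₂, rfl, hw₁, hw₂⟩ := hsplit w hw₁ hw₂
  simp only [map_add, omega_add_left, omega_add_right]
  linear_combination hchar v₁ w₁ hv₁ + hchar v₁ w₂ hv₁ + hchar' v₂ w₁ hw₁ +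
    h.normal_omega i v₂ w₂ hv₂ hw₂

lemma _root_.ContactPairs.nijenhuisJet_add_left (A : E →L[ℝ] E) (A' : E →L[ℝ] E →L[ℝ] E)
    (u v w : E) : nijenhuisJet A A' (u + v) w = nijenhuisJet A A' u w + nijenhuisJet A A' v w := by
  simp only [nijenhuisJet, map_add, _root_.add_apply]; abel

lemma _root_.ContactPairs.nijenhuisJet_smul_left (A : E →L[ℝ] E) (A' : E →L[ℝ] E →L[ℝ] E)
    (c : ℝ) (v w : E) : nijenhuisJet A A' (c • v) w = c • nijenhuisJet A A' v w := by
  simp only [nijenhuisJet, map_smul, _root_.smul_apply, smul_add, smul_sub]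

lemma _root_.ContactPairs.nijenhuisJet_swap (A : E →L[ℝ] E) (A' : E →L[ℝ] E →L[ℝ] E)
    (v w : E) : nijenhuisJet A A' v w = -nijenhuisJet A A' w v := by
  simp only [nijenhuisJet]; abel

lemma _root_.ContactPairs.nijenhuisJet_add_right (A : E →L[ℝ] E) (A' : E →L[ℝ] E →L[ℝ] E)
    (u v w : E) : nijenhuisJet A A' u (v + w) = nijenhuisJet A A' u v + nijenhuisJet A A' u w := by
  rw [nijenhuisJet_swap, nijenhuisJet_add_left, nijenhuisJet_swap A A' v,
    nijenhuisJet_swap A A' w]; abel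

lemma _root_.ContactPairs.nijenhuisJet_smul_right (A : E →L[ℝ] E) (A' : E →L[ℝ] E →L[ℝ] E)
    (c : ℝ) (v w : E) : nijenhuisJet A A' v (c • w) = c • nijenhuisJet A A' v w := by
  rw [nijenhuisJet_swap, nijenhuisJet_smul_left, nijenhuisJet_swap A A' w, smul_neg, neg_neg]

/-- Normality kills `lieEnd i` on the component of the other index. On the component of index `i`,
the Nijenhuis tensor against the other Reeb vector reduces to ± ε times `lieEnd i`. -/
lemma IsContact.lieEnd_eq_zero (h : j.IsContact) (hε : ε = 1 ∨ ε = -1) (hJ : j.IsCpxDeriv ε J')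
    (h0 : ∀ v w, nijenhuisJet (j.cpx ε) J' v w = 0) (i : Bool) {v : E}
    (hv₁ : j.a false v = 0) (hv₂ : j.a true v = 0) : j.lieEnd i v = 0 := by
  have hε0 : ε ≠ 0 := by rcases hε with rfl | rfl <;> norm_num
  obtain ⟨v₁, v₂, rfl, h₁, h₂, h₁', h₂'⟩ := h.exists_add v hv₁ hv₂
  have e₁ : j.lieEnd true v₁ = 0 := h.normal_lieEnd true v₁ h₁
  have e₂ : j.lieEnd false v₂ = 0 := h.normal_lieEnd false v₂ h₂
  have f₁ := nijenhuisJet_cpx_true h hε hJ h₁.1 h₁'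
  have f₂ := nijenhuisJet_cpx_false h hε hJ h₂' h₂.1
  rw [h0, e₁, map_zero, neg_zero, zero_sub, eq_comm, neg_eq_zero, smul_eq_zero_iff_right hε0] at f₁
  rw [h0, e₂, map_zero, neg_zero, zero_add, eq_comm, smul_eq_zero_iff_right hε0] at f₂
  cases i <;> simp [lieEnd_add, e₁, e₂, f₁, f₂]

/-- The vanishing of the Nijenhuis tensor does not depend on the sign of `ε`. -/
theorem IsContact.nijenhuisJet_cpx_neg_eq_zero (h : j.IsContact) (hε : ε = 1 ∨ ε = -1)
    {T' : E →L[ℝ] E →L[ℝ] E} (hJ : j.IsCpxDeriv ε J') (hT : j.IsCpxDeriv (-ε) T')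
    (h0 : ∀ v w, nijenhuisJet (j.cpx ε) J' v w = 0) (v w : E) :
    nijenhuisJet (j.cpx (-ε)) T' v w = 0 := by
  have hε' : -ε = 1 ∨ -ε = -1 := by rcases hε with rfl | rfl <;> simp
  -- On horizontal vectors the ε-terms vanish, so the tensors for ε and -ε coincide.
  have hhor : ∀ v w, j.a false v = 0 → j.a true v = 0 → j.a false w = 0 → j.a true w = 0 →
      nijenhuisJet (j.cpx (-ε)) T' v w = 0 := by
    intro v w hv₁ hv₂ hw₁ hw₂
    have e := nijenhuisJet_cpx_horizontal h hε hJ hv₁ hv₂ hw₁ hw₂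
    rw [h0, h.omega_φ_add_omega_φ_eq_zero false hv₁ hv₂ hw₁ hw₂,
      h.omega_φ_add_omega_φ_eq_zero true hv₁ hv₂ hw₁ hw₂, mul_zero] at e
    rw [nijenhuisJet_cpx_horizontal h hε' hT hv₁ hv₂ hw₁ hw₂,
      h.omega_φ_add_omega_φ_eq_zero false hv₁ hv₂ hw₁ hw₂,
      h.omega_φ_add_omega_φ_eq_zero true hv₁ hv₂ hw₁ hw₂, mul_zero, ← e]
  have hz : ∀ v, j.a false v = 0 → j.a true v = 0 → ∀ i,
      nijenhuisJet (j.cpx (-ε)) T' v (j.z i) = 0 := by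
    intro v hv₁ hv₂ i
    have e₁ := h.lieEnd_eq_zero hε hJ h0 false hv₁ hv₂
    have e₂ := h.lieEnd_eq_zero hε hJ h0 true hv₁ hv₂
    cases i
    · rw [nijenhuisJet_cpx_false h hε' hT hv₁ hv₂, e₁, e₂]; simp
    · rw [nijenhuisJet_cpx_true h hε' hT hv₁ hv₂, e₁, e₂]; simp
  have hzz := nijenhuisJet_cpx_false_true h hε' hT
  have hself : ∀ v, nijenhuisJet (j.cpx (-ε)) T' v v = 0 := fun v ↦ by simp [nijenhuisJet]
  have hdec : ∀ v, ∃ u, j.a false u = 0 ∧ j.a true u = 0 ∧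
      v = u + j.a false v • j.z false + j.a true v • j.z true := fun v ↦
    ⟨v - j.a false v • j.z false - j.a true v • j.z true, by simp [h.a_z], by simp [h.a_z],
      by abel⟩
  obtain ⟨v', hv₁, hv₂, hv⟩ := hdec v
  obtain ⟨w', hw₁, hw₂, hw⟩ := hdec w
  rw [hv, hw]
  simp only [nijenhuisJet_add_left, nijenhuisJet_add_right, nijenhuisJet_smul_left,
    nijenhuisJet_smul_right, hhor v' w' hv₁ hv₂ hw₁ hw₂, hz v' hv₁ hv₂, hself, hzz,
    nijenhuisJet_swap _ _ (j.z _) w', hz w' hw₁ hw₂, nijenhuisJet_swap _ _ (j.z true) (j.z false)]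
  simp

end ContactJet
end ContactPairs

end

/-! ### Linear algebra of a contact pair: splitting and ranks. -/

noncomputable section

namespace ContactPairs

section WedgeAlgebra

variable {V : Type*} [AddCommGroup V] [Module ℝ V]

/-- The contraction of the alternating form `a` with the vector `v` vanishes. -/
def Annihilates {p : ℕ} (v : V) (a : V [⋀^Fin p]→ₗ[ℝ] ℝ) : Prop :=
  ∀ w : Fin p → V, (∃ i, w i = v) → a w = 0

/-- In each shuffle summand the vector `v` occupies a slot of `a` or a slot of `b`. -/
lemma Annihilates.wedge {p q : ℕ} {v : V} {a : V [⋀^Fin p]→ₗ[ℝ] ℝ} {b : V [⋀^Fin q]→ₗ[ℝ] ℝ}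
    (ha : Annihilates v a) (hb : Annihilates v b) : Annihilates v (wedge a b) := by
  rintro w ⟨i, hi⟩
  have hsum : a.domCoprod b (w ∘ finSumFinEquiv) = 0 := by
    rw [AlternatingMap.domCoprod_apply, _root_.sum_apply]
    refine Finset.sum_eq_zero fun σ _ ↦ ?_
    induction σ using Quotient.inductionOn' with
    | h σ =>
      rw [AlternatingMap.domCoprod.summand_mk'', _root_.smul_apply,
        MultilinearMap.domDomCongr_apply, MultilinearMap.domCoprod_apply]
      have hk : w (finSumFinEquiv (σ (σ.symm (finSumFinEquiv.symm i)))) = v := by simpa using hi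
      cases hs : σ.symm (finSumFinEquiv.symm i) with
      | inl k =>
        rw [hs] at hk
        have h0 := ha (fun k ↦ w (finSumFinEquiv (σ (Sum.inl k)))) ⟨k, hk⟩
        change Equiv.Perm.sign σ • (a (fun k ↦ w (finSumFinEquiv (σ (Sum.inl k)))) ⊗ₜ[ℝ] _) = 0
        rw [h0, TensorProduct.zero_tmul, smul_zero]
      | inr k =>
        rw [hs] at hk
        have h0 := hb (fun k ↦ w (finSumFinEquiv (σ (Sum.inr k)))) ⟨k, hk⟩
        change Equiv.Perm.sign σ • (_ ⊗ₜ[ℝ] b (fun k ↦ w (finSumFinEquiv (σ (Sum.inr k))))) = 0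
        rw [h0, TensorProduct.tmul_zero, smul_zero]
  change LinearMap.mul' ℝ ℝ (a.domCoprod b (w ∘ finSumFinEquiv)) = 0
  rw [hsum, map_zero]

lemma annihilates_oneForm {v : V} {a : V →ₗ[ℝ] ℝ} (h : a v = 0) : Annihilates v (oneForm a) := by
  rintro w ⟨i, rfl⟩
  rw [Subsingleton.elim i 0] at h
  exact h

lemma annihilates_of_two {v : V} {b : V [⋀^Fin 2]→ₗ[ℝ] ℝ} (h : ∀ w, b ![v, w] = 0) :
    Annihilates v b := by
  rintro w ⟨i, hi⟩
  have hw : w = ![w 0, w 1] := by ext k; fin_cases k <;> rfl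
  fin_cases i
  · rw [hw, show w 0 = v from hi, h]
  · have hsw := b.map_swap ![v, w 0] (show (0 : Fin 2) ≠ 1 by decide)
    rw [h, neg_zero] at hsw
    rw [← hsw, hw]
    congr 1
    ext k; fin_cases k
    · simp
    · simpa using hi

lemma Annihilates.wedgePow {v : V} {b : V [⋀^Fin 2]→ₗ[ℝ] ℝ} (h : Annihilates v b) :
    ∀ m, Annihilates v (wedgePow b m)
  | 0 => fun _ ⟨i, _⟩ ↦ (Fin.elim0 i)
  | m + 1 => (h.wedgePow m).wedge h

/-- A nonzero form of top degree is annihilated by the zero vector only. -/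
lemma Annihilates.eq_zero {p : ℕ} {v : V} {a : V [⋀^Fin p]→ₗ[ℝ] ℝ} (h : Annihilates v a)
    (ha : a ≠ 0) (hp : 0 < p)
    (hV : Module.finrank ℝ V = p) : v = 0 := by
  by_contra hv
  apply ha
  have : Module.Finite ℝ V := Module.finite_of_finrank_pos (hV ▸ hp)
  have hli : LinearIndepOn ℝ id ({v} : Set V) := LinearIndepOn.singleton (by simpa using hv)
  let B := Module.Basis.extend hli
  have hvB : v ∈ hli.extend (subset_univ _) := hli.subset_extend _ rfl
  -- It suffices to test injective families from a basis containing `v`. With `p` members such a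
  -- family exhausts the basis, so it contains `v`.
  refine Module.Basis.ext_alternating B fun f hf ↦ ?_
  have : Fintype (hli.extend (subset_univ _)) := FiniteDimensional.fintypeBasisIndex B
  have hcard : Fintype.card (Fin p) = Fintype.card (hli.extend (subset_univ _)) := by
    rw [← Module.finrank_eq_card_basis B, hV, Fintype.card_fin]
  obtain ⟨i, hi⟩ := ((Fintype.bijective_iff_injective_and_card f).2 ⟨hf, hcard⟩).2 ⟨v, hvB⟩
  exact h _ ⟨i, by simp [hi, B]⟩

/-- The product of `m` copies of a bilinear map, as a multilinear map. -/
def bilinPow (B : MultilinearMap ℝ (fun _ : Fin 2 ↦ V) ℝ) :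
    (m : ℕ) → MultilinearMap ℝ (fun _ : Fin (2 * m) ↦ V) ℝ
  | 0 => MultilinearMap.constOfIsEmpty ℝ (fun _ : Fin 0 ↦ V) (1 : ℝ)
  | m + 1 => ((LinearMap.mul' ℝ ℝ).compMultilinearMap
      ((bilinPow B m).domCoprod B)).domDomCongr finSumFinEquiv

lemma alternatization_domDomCongr {ι ι' : Type*} [Fintype ι] [DecidableEq ι] [Fintype ι']
    [DecidableEq ι'] (e : ι ≃ ι') (f : MultilinearMap ℝ (fun _ : ι ↦ V) ℝ) :
    MultilinearMap.alternatization (f.domDomCongr e) =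
      (MultilinearMap.alternatization f).domDomCongr e := by
  ext v
  rw [AlternatingMap.domDomCongr_apply, MultilinearMap.alternatization_apply,
    MultilinearMap.alternatization_apply]
  refine (Fintype.sum_equiv e.permCongr _ _ fun σ ↦ ?_).symm
  rw [Equiv.Perm.sign_permCongr]
  simp [MultilinearMap.domDomCongr_apply, Equiv.permCongr_apply]

/-- Alternatization turns tensor products into shuffle products with no factorial factor. An
iterated wedge power thus becomes a single sum over all permutations, which can be evaluated on
explicit vectors. -/
lemma wedgePow_alternatization (B : MultilinearMap ℝ (fun _ : Fin 2 ↦ V) ℝ) :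
    ∀ m, wedgePow (MultilinearMap.alternatization B) m =
      MultilinearMap.alternatization (bilinPow B m)
  | 0 => by
    ext w
    rw [MultilinearMap.alternatization_apply]
    have : Unique (Equiv.Perm (Fin (2 * 0))) := inferInstanceAs (Unique (Equiv.Perm (Fin 0)))
    rw [Fintype.sum_eq_single 1 fun σ h ↦ absurd (Subsingleton.elim σ 1) h,
      Equiv.Perm.sign_one, one_smul]
    rfl
  | m + 1 => by
    rw [wedgePow, wedgePow_alternatization B m, bilinPow, alternatization_domDomCongr,
      LinearMap.compMultilinearMap_alternatization, MultilinearMap.domCoprod_alternization]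
    rfl

/-- The elements of `Fin (2 * m)`, as `m` pairs of consecutive elements. -/
def pairEquiv (m : ℕ) : Fin m × Fin 2 ≃ Fin (2 * m) :=
  finProdFinEquiv.trans (finCongr (Nat.mul_comm m 2))

lemma bilinPow_apply (B : MultilinearMap ℝ (fun _ : Fin 2 ↦ V) ℝ) :
    ∀ (m : ℕ) (v : Fin (2 * m) → V),
      bilinPow B m v = ∏ i : Fin m, B (fun c ↦ v (pairEquiv m (i, c)))
  | 0, v => rfl
  | m + 1, v => by
    rw [Fin.prod_univ_castSucc]
    change bilinPow B m (fun k ↦ v (finSumFinEquiv (Sum.inl k))) *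
      B (fun k ↦ v (finSumFinEquiv (Sum.inr k))) = _
    rw [bilinPow_apply B m]
    congr 2
    ext c
    congr 1
    ext
    simp [pairEquiv, finProdFinEquiv, add_comm]

/-- The value of the `m`-th wedge power of a two-form on `m` hyperbolic pairs is positive. -/
lemma wedgePow_ne_zero (b : V [⋀^Fin 2]→ₗ[ℝ] ℝ) (m : ℕ) (e : Fin m × Fin 2 → V)
    (h₁ : ∀ i, b ![e (i, 0), e (i, 1)] = 1)
    (h₀ : ∀ i c k d, i ≠ k → b ![e (i, c), e (k, d)] = 0) : wedgePow b m ≠ 0 := by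
  -- The factor `1 / 2` compensates for the two permutations in the alternatization.
  set B : MultilinearMap ℝ (fun _ : Fin 2 ↦ V) ℝ := (1 / 2 : ℝ) • b.toMultilinearMap with hB
  have hb : b = MultilinearMap.alternatization B := by
    ext v
    rw [MultilinearMap.alternatization_apply]
    have hσ : ∀ σ : Equiv.Perm (Fin 2),
        Equiv.Perm.sign σ • B.domDomCongr σ v = (1 / 2 : ℝ) * b v := by
      intro σ
      change Equiv.Perm.sign σ • ((1 / 2 : ℝ) * b (v ∘ σ)) = _
      rw [b.map_perm, mul_smul_comm, smul_smul, Int.units_mul_self, one_smul]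
    rw [Finset.sum_congr rfl fun σ _ ↦ hσ σ]
    simp [Fintype.card_perm]
  have hval : wedgePow b m (e ∘ (pairEquiv m).symm) =
      ∑ σ : Equiv.Perm (Fin m × Fin 2),
        (Equiv.Perm.sign σ : ℝ) * ∏ i : Fin m, B (fun c ↦ e (σ (i, c))) := by
    conv_lhs => rw [hb]
    rw [wedgePow_alternatization, MultilinearMap.alternatization_apply]
    refine (Fintype.sum_equiv (pairEquiv m).permCongr _ _ fun σ ↦ ?_).symm
    rw [Equiv.Perm.sign_permCongr, MultilinearMap.domDomCongr_apply, bilinPow_apply]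
    simp [Equiv.permCongr_apply, Units.smul_def]
  suffices h : 0 < wedgePow b m (e ∘ (pairEquiv m).symm) from
    fun h0 ↦ h.ne' (by rw [h0, AlternatingMap.zero_apply])
  have hBval : ∀ (σ : Equiv.Perm (Fin 2)) (k : Fin m),
      B (fun c ↦ e (k, σ c)) = 1 / 2 * (Equiv.Perm.sign σ : ℝ) := by
    intro σ k
    change (1 / 2 : ℝ) * b ((fun c ↦ e (k, c)) ∘ σ) = _
    rw [b.map_perm, show (fun c ↦ e (k, c)) = ![e (k, 0), e (k, 1)] by
      ext c; fin_cases c <;> rfl, h₁]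
    simp [Units.smul_def]
  rw [hval]
  refine Finset.sum_pos' (fun σ _ ↦ ?_) ⟨1, Finset.mem_univ _, ?_⟩
  · by_cases h0 : ∏ i : Fin m, B (fun c ↦ e (σ (i, c))) = 0
    · rw [h0, mul_zero]
    -- A nonzero summand forces σ to map pairs to pairs, since vectors of different pairs are
    -- orthogonal.
    have hpair : ∀ i c, (σ (i, c)).1 = (σ (i, 0)).1 := by
      intro i c
      by_contra hne
      have hc : c = 1 := by
        by_contra hc
        exact hne (by rw [show c = 0 by omega])
      subst hc
      refine Finset.prod_ne_zero_iff.1 h0 i (Finset.mem_univ _) ?_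
      change (1 / 2 : ℝ) * b (fun c ↦ e (σ (i, c))) = 0
      rw [show (fun c ↦ e (σ (i, c))) = ![e (σ (i, 0)), e (σ (i, 1))] by
        ext c; fin_cases c <;> rfl, h₀ _ _ _ _ (Ne.symm hne), mul_zero]
    have hρ : Function.Surjective fun i ↦ (σ (i, 0)).1 := fun k ↦
      ⟨(σ.symm (k, 0)).1, by
        change (σ ((σ.symm (k, 0)).1, 0)).1 = k
        rw [← hpair _ (σ.symm (k, 0)).2]; simp⟩
    let ρ : Equiv.Perm (Fin m) :=
      Equiv.ofBijective _ ⟨Finite.injective_iff_surjective.2 hρ, hρ⟩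
    have hs : ∀ i, Function.Injective fun c ↦ (σ (i, c)).2 := by
      intro i c d hcd
      have : σ (i, c) = σ (i, d) :=
        Prod.ext ((hpair i c).trans (hpair i d).symm) hcd
      simpa using σ.injective this
    let s : Fin m → Equiv.Perm (Fin 2) := fun i ↦
      Equiv.ofBijective _ (Finite.injective_iff_bijective.1 (hs i))
    have hσ : ∀ i c, σ (i, c) = (ρ i, s i c) := fun i c ↦ Prod.ext (hpair i c) rfl
    -- The permutation ρ of the pairs acts on both members, so it contributes the square of its
    -- sign. The signs of the `s i` cancel those of the factors of the product, and the summand is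
    -- nonnegative.
    have hdec : σ = Equiv.prodCongrLeft (fun _ : Fin 2 ↦ ρ) * Equiv.prodCongrRight s := by
      ext1 ⟨i, c⟩
      rw [hσ]; rfl
    have hsign : Equiv.Perm.sign σ = ∏ i, Equiv.Perm.sign (s i) := by
      conv_lhs => rw [hdec]
      rw [Equiv.Perm.sign_mul, Equiv.Perm.sign_prodCongrLeft, Equiv.Perm.sign_prodCongrRight]
      simp
    simp only [hσ, hBval, hsign]
    push_cast
    rw [← Finset.prod_mul_distrib]
    refine Finset.prod_nonneg fun i _ ↦ ?_
    rcases Int.units_eq_one_or (Equiv.Perm.sign (s i)) with h | h <;> rw [h] <;> norm_num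
  · have := fun k ↦ hBval 1 k
    simp only [Equiv.Perm.one_apply, Equiv.Perm.sign_one, Units.val_one, Int.cast_one,
      mul_one] at this ⊢
    simp only [this, one_mul]
    positivity

/-- If the `m + 1`-st power of a two-form vanishes, then its rank is at most `2 m`. -/
lemma finrank_le_of_wedgePow_eq_zero [FiniteDimensional ℝ V] (b : V [⋀^Fin 2]→ₗ[ℝ] ℝ) (m : ℕ)
    (hb : wedgePow b (m + 1) = 0) (K : Submodule ℝ V) (hK : ∀ v, v ∈ K ↔ ∀ w, b ![v, w] = 0) :
    Module.finrank ℝ V ≤ Module.finrank ℝ K + 2 * m := by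
  have hsw : ∀ v w, b ![v, w] = -b ![w, v] := fun v w ↦ by
    rw [← b.map_swap ![w, v] (show (0 : Fin 2) ≠ 1 by decide)]
    congr 1
    ext k; fin_cases k <;> simp
  have hleft : ∀ v w, b ![v, w] = b.curryLeft v ![w] := fun v w ↦ rfl
  let β : V →ₗ[ℝ] V →ₗ[ℝ] ℝ := LinearMap.mk₂ ℝ (fun v w ↦ b ![v, w])
    (fun v v' w ↦ by simp only [hleft, map_add, AlternatingMap.add_apply])
    (fun c v w ↦ by simp only [hleft, map_smul, AlternatingMap.smul_apply])
    (fun v w w' ↦ by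
      rw [hsw v, hsw v w, hsw v w']
      simp only [hleft, map_add, AlternatingMap.add_apply, neg_add])
    (fun c v w ↦ by
      rw [hsw v, hsw v w]
      simp only [hleft, map_smul, AlternatingMap.smul_apply, smul_neg])
  have hβ : ∀ v w, b ![v, w] = β v w := fun v w ↦ rfl
  simp only [hβ] at hsw hK
  have hself : ∀ v, β v v = 0 := fun v ↦ by linarith [hsw v v]
  -- Hyperbolic pairs are collected greedily. If the process cannot reach `l` pairs, the orthogonal
  -- of the fewer pairs found, of codimension at most `2 * (l - 1)`, lies in `K`.
  have key : ∀ l, (∃ e : Fin l × Fin 2 → V, (∀ i, β (e (i, 0)) (e (i, 1)) = 1) ∧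
      ∀ i c k d, i ≠ k → β (e (i, c)) (e (k, d)) = 0) ∨
      Module.finrank ℝ V + 2 ≤ Module.finrank ℝ K + 2 * l := by
    intro l
    induction l with
    | zero => exact Or.inl ⟨fun p ↦ Fin.elim0 p.1, fun i ↦ Fin.elim0 i, fun i ↦ Fin.elim0 i⟩
    | succ l ih =>
      rcases ih with ⟨e, h₁, h₀⟩ | h
      swap
      · right; omega
      by_cases hW : ∃ x y, (∀ p, β (e p) x = 0) ∧ (∀ p, β (e p) y = 0) ∧ β x y ≠ 0
      · left
        obtain ⟨x, y, hx, hy, hxy⟩ := hW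
        have hx' : ∀ p, β x (e p) = 0 := fun p ↦ by rw [hsw, hx, neg_zero]
        have hy' : ∀ p, β y (e p) = 0 := fun p ↦ by rw [hsw, hy, neg_zero]
        refine ⟨fun p ↦ Fin.lastCases (motive := fun _ ↦ V) (![x, (β x y)⁻¹ • y] p.2)
          (fun i ↦ e (i, p.2)) p.1, fun i ↦ ?_, fun i c k d hik ↦ ?_⟩
        · induction i using Fin.lastCases with
          | last => simp [hxy]
          | cast i => simpa using h₁ i
        · induction i using Fin.lastCases with
          | last =>
            induction k using Fin.lastCases with
            | last => exact absurd rfl hik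
            | cast k => fin_cases c <;> simp [hx', hy']
          | cast i =>
            induction k using Fin.lastCases with
            | last => fin_cases d <;> simp [hx, hy]
            | cast k => simpa using h₀ i c k d (fun h ↦ hik (by rw [h]))
      · right
        push Not at hW
        let L : V →ₗ[ℝ] (Fin l × Fin 2 → ℝ) := LinearMap.pi fun p ↦ β (e p)
        have hLK : LinearMap.ker L ≤ K := by
          intro v hv
          have hv' : ∀ p, β (e p) v = 0 := fun p ↦ congrFun (LinearMap.mem_ker.1 hv) p
          refine (hK v).2 fun u ↦ ?_
          -- The component of `u` in the span of the pairs: `u - s` is orthogonal to all of them,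
          -- and `v` is orthogonal to `s`.
          set s := ∑ i, (β u (e (i, 1)) • e (i, 0) - β u (e (i, 0)) • e (i, 1)) with hs
          have hvs : β v s = 0 := by
            rw [hs, map_sum]
            refine Finset.sum_eq_zero fun i _ ↦ ?_
            rw [map_sub, map_smul, map_smul, hsw v, hv', hsw v, hv']
            simp
          have hus : ∀ p, β (e p) (u - s) = 0 := by
            rintro ⟨k, c⟩
            rw [map_sub, hs, map_sum, Finset.sum_eq_single k]
            · fin_cases c
              · simp [h₁, hself, hsw u (e (k, 0))]
              · simp [h₁, hself, hsw (e (k, 1)) (e (k, 0)), hsw u (e (k, 1))]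
            · intro i _ hik
              simp [h₀ k c i _ (Ne.symm hik)]
            · simp
          have := hW v (u - s) hv' hus
          rw [map_sub, hvs, sub_zero] at this
          exact this
        have h1 := Submodule.finrank_mono hLK
        have h2 := LinearMap.finrank_range_add_finrank_ker L
        have h3 := Submodule.finrank_le (LinearMap.range L)
        rw [Module.finrank_fintype_fun_eq_card] at h3
        simp at h3
        omega
  rcases key (m + 1) with ⟨e, h₁, h₀⟩ | h
  · exact absurd hb (wedgePow_ne_zero b _ e h₁ h₀)
  · omega

/-- The characteristic subspaces of a linear contact pair. -/
theorem isCompl_of_wedge_ne_zero [FiniteDimensional ℝ V] {h k : ℕ} {a₁ a₂ : V →ₗ[ℝ] ℝ}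
    {b₁ b₂ : V [⋀^Fin 2]→ₗ[ℝ] ℝ} (hV : Module.finrank ℝ V = 2 * h + 2 * k + 2)
    (hvol : wedge (wedge (wedge (oneForm a₁) (wedgePow b₁ h)) (oneForm a₂)) (wedgePow b₂ k) ≠ 0)
    (h₁ : wedgePow b₁ (h + 1) = 0) (h₂ : wedgePow b₂ (k + 1) = 0) {D₁ D₂ : Submodule ℝ V}
    (hD₁ : ∀ v, v ∈ D₁ ↔ a₁ v = 0 ∧ ∀ w, b₁ ![v, w] = 0)
    (hD₂ : ∀ v, v ∈ D₂ ↔ a₂ v = 0 ∧ ∀ w, b₂ ![v, w] = 0) :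
    IsCompl D₁ D₂ ∧ Module.finrank ℝ D₁ = 2 * k + 1 ∧ Module.finrank ℝ D₂ = 2 * h + 1 := by
  -- `D` is the kernel of the two-form, of codimension at most `2 * m`, cut by one more linear form.
  have hrank : ∀ (a : V →ₗ[ℝ] ℝ) (b : V [⋀^Fin 2]→ₗ[ℝ] ℝ) (m : ℕ), wedgePow b (m + 1) = 0 →
      ∀ D : Submodule ℝ V, (∀ v, v ∈ D ↔ a v = 0 ∧ ∀ w, b ![v, w] = 0) →
      2 * h + 2 * k + 2 ≤ Module.finrank ℝ D + 2 * m + 1 := by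
    intro a b m hb D hD
    have hleft : ∀ v w, b ![v, w] = b.curryLeft v ![w] := fun v w ↦ rfl
    let K : Submodule ℝ V :=
      { carrier := {v | ∀ w, b ![v, w] = 0}
        zero_mem' := fun w ↦ by rw [hleft, map_zero, AlternatingMap.zero_apply]
        add_mem' := fun {u v} hu hv w ↦ by
          rw [hleft, map_add, AlternatingMap.add_apply, ← hleft, ← hleft, hu, hv, add_zero]
        smul_mem' := fun c u hu w ↦ by
          rw [hleft, map_smul, AlternatingMap.smul_apply, ← hleft, hu, smul_zero] }
    have hK := finrank_le_of_wedgePow_eq_zero b m hb K fun v ↦ Iff.rfl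
    have hDK : D = K ⊓ LinearMap.ker a := by
      ext v
      rw [hD, Submodule.mem_inf, LinearMap.mem_ker, and_comm]
      rfl
    have h0 := Submodule.finrank_sup_add_finrank_inf_eq K (LinearMap.ker a)
    have h1 := Submodule.finrank_le (K ⊔ LinearMap.ker a)
    have h2 := LinearMap.finrank_range_add_finrank_ker a
    have h3 := Submodule.finrank_le (LinearMap.range a)
    rw [Module.finrank_self] at h3
    rw [hDK]
    omega
  have hdisj : Disjoint D₁ D₂ := by
    rw [Submodule.disjoint_def]
    intro v hv₁ hv₂
    rw [hD₁] at hv₁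
    rw [hD₂] at hv₂
    -- A common vector would be annihilated by every factor of the volume form.
    refine Annihilates.eq_zero ((((annihilates_oneForm hv₁.1).wedge
      ((annihilates_of_two hv₁.2).wedgePow h)).wedge (annihilates_oneForm hv₂.1)).wedge
      ((annihilates_of_two hv₂.2).wedgePow k)) hvol (by omega) (by omega)
  have r₁ := hrank a₁ b₁ h h₁ D₁ hD₁
  have r₂ := hrank a₂ b₂ k h₂ D₂ hD₂
  -- The lower bounds `2 * k + 1` and `2 * h + 1` already add up to the dimension of `V`, so
  -- disjointness forces equality in both.
  have hle := Submodule.finrank_add_finrank_le_of_disjoint hdisj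
  refine ⟨⟨hdisj, ?_⟩, by omega, by omega⟩
  rw [codisjoint_iff]
  refine Submodule.eq_top_of_finrank_eq ?_
  have := Submodule.finrank_sup_add_finrank_inf_eq D₁ D₂
  rw [hdisj.eq_bot, finrank_bot] at this
  omega

end WedgeAlgebra
end ContactPairs

end

/-! ### Integral manifolds of the characteristic distribution. -/

noncomputable section

open Metric Filter Topology
open scoped NNReal

namespace ContactPairs

lemma two_le_infty : (2 : WithTop ℕ∞) ≤ ∞ := WithTop.coe_le_coe.2 (le_top : (2 : ℕ∞) ≤ ⊤)

section Distribution

variable {E : Type*} [NormedAddCommGroup E] [NormedSpace ℝ E]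

/-- The kernel of a one-form and of its exterior derivative, in a vector space. -/
def localCharacteristic (a : E → E →L[ℝ] ℝ) (y : E) : Submodule ℝ E :=
  LinearMap.ker (a y).toLinearMap ⊓
    LinearMap.ker (fderiv ℝ a y - (fderiv ℝ a y).flip).toLinearMap

lemma mem_localCharacteristic {a : E → E →L[ℝ] ℝ} {y v : E} :
    v ∈ localCharacteristic a y ↔
      a y v = 0 ∧ ∀ w, fderiv ℝ a y v w - fderiv ℝ a y w v = 0 := by
  simp [localCharacteristic, ContinuousLinearMap.ext_iff]

set_option synthInstance.maxHeartbeats 200000 in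
/-- The characteristic distribution of a one-form is involutive. -/
lemma bracket_mem_localCharacteristic {F : Type*} [NormedAddCommGroup F] [NormedSpace ℝ F]
    {a : E → E →L[ℝ] ℝ} {s : E → F →L[ℝ] E} {y : E} (ha : ContDiffAt ℝ 2 a y)
    (hs : DifferentiableAt ℝ s y) (hmem : ∀ᶠ x in 𝓝 y, ∀ u, s x u ∈ localCharacteristic a x)
    (u w : F) :
    fderiv ℝ s y (s y u) w - fderiv ℝ s y (s y w) u ∈ localCharacteristic a y := by
  have ha1 : HasFDerivAt a (fderiv ℝ a y) y := (ha.differentiableAt (by norm_num)).hasFDerivAt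
  have ha2 : HasFDerivAt (fderiv ℝ a) (fderiv ℝ (fderiv ℝ a) y) y :=
    ((ha.fderiv_right (m := 1) (by norm_num)).differentiableAt (by norm_num)).hasFDerivAt
  have hsymm : ∀ v w, fderiv ℝ (fderiv ℝ a) y v w = fderiv ℝ (fderiv ℝ a) y w v :=
    ha.isSymmSndFDerivAt (by simp)
  have hsu : ∀ u, HasFDerivAt (fun x ↦ s x u) ((fderiv ℝ s y).flip u) y := fun u ↦ by
    simpa using hs.hasFDerivAt.clm_apply (hasFDerivAt_const u y)
  have hy := mem_localCharacteristic.1 (hmem.self_of_nhds u)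
  have hyw := mem_localCharacteristic.1 (hmem.self_of_nhds w)
  have h1 : ∀ u v, fderiv ℝ a y v (s y u) + a y (fderiv ℝ s y v u) = 0 := by
    intro u v
    have h := ha1.clm_apply (hsu u)
    have h0 : HasFDerivAt (fun x ↦ a x (s x u)) (0 : E →L[ℝ] ℝ) y :=
      (hasFDerivAt_const (0 : ℝ) y).congr_of_eventuallyEq
        (hmem.mono fun x hx ↦ (mem_localCharacteristic.1 (hx u)).1)
    have := DFunLike.congr_fun (h.unique h0) v
    simp at this
    linarith
  -- `h1` and `h2` differentiate along `v` the identities a(s u) = 0 and da(s u, c) = 0, valid near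
  -- `y`.
  have h2 : ∀ u v c, fderiv ℝ (fderiv ℝ a) y v (s y u) c + fderiv ℝ a y (fderiv ℝ s y v u) c
      - fderiv ℝ (fderiv ℝ a) y v c (s y u) - fderiv ℝ a y c (fderiv ℝ s y v u) = 0 := by
    intro u v c
    have hA := (ha2.clm_apply (hsu u)).clm_apply (hasFDerivAt_const c y)
    have hB := (ha2.clm_apply (hasFDerivAt_const c y)).clm_apply (hsu u)
    have h0 : HasFDerivAt (fun x ↦ fderiv ℝ a x (s x u) c - fderiv ℝ a x c (s x u))
        (0 : E →L[ℝ] ℝ) y :=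
      (hasFDerivAt_const (0 : ℝ) y).congr_of_eventuallyEq
        (hmem.mono fun x hx ↦ (mem_localCharacteristic.1 (hx u)).2 c)
    have := DFunLike.congr_fun ((hA.sub hB).unique h0) v
    simp at this
    linarith
  refine mem_localCharacteristic.2 ⟨?_, fun c ↦ ?_⟩
  · rw [map_sub]
    linarith [h1 w (s y u), h1 u (s y w), hy.2 (s y w)]
  -- The symmetry of the second derivative, that is d(da) = 0, removes all second order terms of
  -- `a`.
  · simp only [map_sub, _root_.sub_apply]
    have e1 := h2 w (s y u) c
    have e2 := h2 u (s y w) c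
    have e3 := h2 u c (s y w)
    have e4 := hyw.2 (fderiv ℝ s y c u)
    have e5 := DFunLike.congr_fun (hsymm (s y u) (s y w)) c
    have e6 := DFunLike.congr_fun (hsymm (s y u) c) (s y w)
    have e7 := DFunLike.congr_fun (hsymm (s y w) c) (s y u)
    linarith

/-- `L` inverts `K` on a complement of its kernel, so that `1 - L K` projects onto the kernel. -/
lemma exists_generalized_inverse {G : Type*} [NormedAddCommGroup G] [NormedSpace ℝ G]
    [FiniteDimensional ℝ E] [FiniteDimensional ℝ G] (K : E →L[ℝ] G) :
    ∃ L : G →L[ℝ] E, (∀ x, L (K (L x)) = L x) ∧ ∀ v, L (K v) = 0 → K v = 0 := by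
  obtain ⟨C, hC⟩ := Submodule.exists_isCompl (LinearMap.ker K.toLinearMap)
  have hinj : LinearMap.ker (K.toLinearMap.domRestrict C) = ⊥ := by
    rw [LinearMap.ker_eq_bot']
    intro c hc
    have : (c : E) ∈ LinearMap.ker K.toLinearMap ⊓ C := ⟨hc, c.2⟩
    rw [hC.inf_eq_bot, Submodule.mem_bot] at this
    exact Subtype.ext this
  obtain ⟨g, hg⟩ := LinearMap.exists_leftInverse_of_injective _ hinj
  have hg' : ∀ c : C, g (K c) = c := fun c ↦ LinearMap.congr_fun hg c
  refine ⟨LinearMap.toContinuousLinearMap (C.subtype ∘ₗ g), fun x ↦ ?_, fun v hv ↦ ?_⟩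
  · change ((g (K (g x))) : E) = g x
    rw [hg']
  · have hv' : g (K v) = 0 := Subtype.ext hv
    obtain ⟨k, hk, c, hc, rfl⟩ := Submodule.mem_sup.1
      (show v ∈ LinearMap.ker K.toLinearMap ⊔ C by rw [hC.sup_eq_top]; trivial)
    have hk' : K k = 0 := hk
    rw [map_add, hk', zero_add] at hv' ⊢
    have := hg' ⟨c, hc⟩
    rw [hv'] at this
    rw [show c = 0 from (congrArg Subtype.val this).symm, map_zero]

/-- A local frame of a smooth distribution of constant rank that is given as a kernel. -/
lemma exists_local_frame {G : Type*} [NormedAddCommGroup G] [NormedSpace ℝ G]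
    [FiniteDimensional ℝ E] [FiniteDimensional ℝ G] {V : Set E} (hV : IsOpen V)
    {K : E → E →L[ℝ] G} (hK : ContDiffOn ℝ ∞ K V) {m : ℕ}
    (hm : ∀ y ∈ V, Module.finrank ℝ (LinearMap.ker (K y).toLinearMap) = m) {y₀ : E} (hy₀ : y₀ ∈ V) :
    ∃ U ⊆ V, IsOpen U ∧ y₀ ∈ U ∧
      ∃ (s : E → EuclideanSpace ℝ (Fin m) →L[ℝ] E) (l : E →L[ℝ] EuclideanSpace ℝ (Fin m)),
        ContDiffOn ℝ ∞ s U ∧ ∀ y ∈ U, (∀ u, l (s y u) = u) ∧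
          LinearMap.range (s y).toLinearMap = LinearMap.ker (K y).toLinearMap := by
  obtain ⟨L, hL, hLK⟩ := exists_generalized_inverse (K y₀)
  set p : E →L[ℝ] E := 1 - L.comp (K y₀) with hp
  have hpv : ∀ v, p v = v - L (K y₀ v) := fun v ↦ rfl
  -- `Q y₀` is the identity, so `Q y` is invertible for `y` near `y₀`. It maps the kernel of `K y`
  -- into that of `K y₀`, and its inverse transports a fixed frame.
  set Q : E → E →L[ℝ] E := fun y ↦ p + L.comp (K y) with hQ
  have hQv : ∀ y v, Q y v = p v + L (K y v) := fun y v ↦ rfl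
  have hpL : ∀ x, p (L x) = 0 := fun x ↦ by rw [hpv, hL, sub_self]
  have hpp : ∀ v, p (p v) = p v := fun v ↦ by rw [hpv v, map_sub, hpL, sub_zero, hpv]
  have hKp : ∀ v, K y₀ (p v) = 0 := fun v ↦ hLK _ (by rw [hpv, map_sub, map_sub, hL, sub_self])
  have hQsm : ContDiffOn ℝ ∞ Q V := contDiffOn_const.add (contDiffOn_const.clm_comp hK)
  have hQ0 : Q y₀ = 1 := by rw [hQ, hp]; simp
  have hunit : IsOpen {y ∈ V | IsUnit (Q y)} :=
    hQsm.continuousOn.isOpen_inter_preimage hV Units.isOpen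
  obtain ⟨e⟩ : Nonempty (EuclideanSpace ℝ (Fin m) ≃L[ℝ] LinearMap.ker (K y₀).toLinearMap) :=
    FiniteDimensional.nonempty_continuousLinearEquiv_of_finrank_eq (by
      rw [hm y₀ hy₀, finrank_euclideanSpace_fin])
  set j : EuclideanSpace ℝ (Fin m) →L[ℝ] E :=
    (LinearMap.ker (K y₀).toLinearMap).subtypeL.comp (e : _ →L[ℝ] _) with hj
  have hKj : ∀ u, K y₀ (j u) = 0 := fun u ↦ (e u).2
  have hpj : ∀ u, p (j u) = j u := fun u ↦ by rw [hpv, hKj, map_zero, sub_zero]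
  have hjp : ∀ v, ∃ u, j u = p v := fun v ↦ ⟨e.symm ⟨p v, hKp v⟩, by simp [hj]⟩
  -- Since `p ∘ Q y = p`, the same projection `p` inverts the frame at every `y`; this gives a left
  -- inverse `l` that does not depend on `y`.
  refine ⟨{y ∈ V | IsUnit (Q y)}, fun y hy ↦ hy.1, hunit, ⟨hy₀, hQ0 ▸ isUnit_one⟩,
    fun y ↦ (Ring.inverse (Q y)).comp j,
    (e.symm : _ →L[ℝ] _).comp (p.codRestrict (LinearMap.ker (K y₀).toLinearMap) hKp), ?_, ?_⟩
  · refine ContDiffOn.clm_comp (fun y hy ↦ ?_) contDiffOn_const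
    obtain ⟨x, hx⟩ := hy.2
    have h1 : ContDiffAt ℝ ∞ Ring.inverse (Q y) := hx ▸ contDiffAt_ringInverse ℝ x
    exact h1.comp_contDiffWithinAt y ((hQsm y hy.1).mono fun z hz ↦ hz.1)
  · rintro y ⟨hyV, hy⟩
    have hQi : ∀ v, Q y (Ring.inverse (Q y) v) = v := fun v ↦
      DFunLike.congr_fun (Ring.mul_inverse_cancel _ hy) v
    have hiQ : ∀ v, Ring.inverse (Q y) (Q y v) = v := fun v ↦
      DFunLike.congr_fun (Ring.inverse_mul_cancel _ hy) v
    have hpQ : ∀ v, p (Q y v) = p v := fun v ↦ by rw [hQv, map_add, hpp, hpL, add_zero]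
    have hps : ∀ u, p (Ring.inverse (Q y) (j u)) = j u := fun u ↦ by rw [← hpQ, hQi, hpj]
    constructor
    · intro u
      change e.symm ⟨p (Ring.inverse (Q y) (j u)), _⟩ = u
      rw [ContinuousLinearEquiv.symm_apply_eq]
      exact Subtype.ext (hps u)
    · symm
      -- Only one inclusion is checked; constancy of the rank supplies the other.
      refine Submodule.eq_of_le_of_finrank_le (fun v hv ↦ ?_) ?_
      · obtain ⟨u, hu⟩ := hjp v
        have hv' : K y v = 0 := hv
        refine ⟨u, ?_⟩
        change Ring.inverse (Q y) (j u) = v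
        have hQv' : Q y v = p v := by rw [hQv, hv', map_zero, add_zero]
        rw [hu, ← hQv', hiQ]
      · rw [hm y hyV]
        refine (LinearMap.finrank_range_le _).trans ?_
        rw [finrank_euclideanSpace_fin]

/-- Through every point there is an integral manifold of an involutive distribution: it is
parametrized by a vector space, with a smooth left inverse `q` of the differential. -/
lemma exists_integral_immersion [CompleteSpace E] {F : Type*} [NormedAddCommGroup F]
    [InnerProductSpace ℝ F] {U : Set E} (hU : IsOpen U)
    {s : E → F →L[ℝ] E} {l : E →L[ℝ] F}
    (hs : ContDiffOn ℝ ∞ s U) (hl : ∀ y ∈ U, ∀ u, l (s y u) = u)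
    (hinv : ∀ y ∈ U, ∀ u w, ∃ z, fderiv ℝ s y (s y u) w - fderiv ℝ s y (s y w) u = s y z)
    {y₀ : E} (hy₀ : y₀ ∈ U) :
    ∃ (g : F → E)
      (q : F → E →L[ℝ] F),
      ContDiff ℝ ∞ g ∧ ContDiff ℝ ∞ q ∧ g 0 = y₀ ∧ Function.Injective g ∧ (∀ x, g x ∈ U) ∧
      (∀ x u, q x (fderiv ℝ g x u) = u) ∧
      ∀ x, LinearMap.range (fderiv ℝ g x).toLinearMap = LinearMap.range (s (g x)).toLinearMap := by
  -- As `l ∘ s` is constant, `l` kills the derivatives of `s`. A bracket of frame fields is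
  -- therefore killed by `l`, and being of the form `s y z` it vanishes: the frame fields commute.
  have hsym : ∀ y ∈ U, ∀ u w, fderiv ℝ s y (s y u) w = fderiv ℝ s y (s y w) u := by
    intro y hy u w
    have hl0 : ∀ v w, l (fderiv ℝ s y v w) = 0 := by
      intro v w
      have hd : DifferentiableAt ℝ s y :=
        (hs.contDiffAt (hU.mem_nhds hy)).differentiableAt (by simp)
      have h1 := l.hasFDerivAt.comp y (hd.hasFDerivAt.clm_apply (hasFDerivAt_const w y))
      have h2 : HasFDerivAt (fun y ↦ l (s y w)) (0 : E →L[ℝ] F) y :=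
        (hasFDerivAt_const w y).congr_of_eventuallyEq
          (Filter.eventuallyEq_of_mem (hU.mem_nhds hy) fun x hx ↦ hl x hx w)
      have := DFunLike.congr_fun (h1.unique h2) v
      simpa using this
    obtain ⟨z, hz⟩ := hinv y hy u w
    have h := congrArg l hz
    rw [map_sub, hl0, hl0, hl y hy, sub_zero] at h
    rw [← h, map_zero] at hz
    exact sub_eq_zero.1 hz
  obtain ⟨r, hr, f, hf0, hf⟩ := exists_hasFDerivAt_eq
    ((hs.contDiffAt (hU.mem_nhds hy₀)).of_le two_le_infty)
    (Filter.eventually_of_mem (hU.mem_nhds hy₀) hsym) (hU.mem_nhds hy₀)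
  have hfs : ContDiffOn ℝ ∞ f (ball 0 r) := contDiffOn_of_hasFDerivAt_eq hs isOpen_ball hf
  -- A diffeomorphism from the whole of `F` onto the ball, so that the integral manifold is
  -- parametrized by a vector space.
  set ψ := OpenPartialHomeomorph.univBall (0 : F) r with hψ
  have hψs : ContDiff ℝ ∞ ψ := OpenPartialHomeomorph.contDiff_univBall
  have hψs' : ContDiffOn ℝ ∞ ψ.symm (ball 0 r) := OpenPartialHomeomorph.contDiffOn_univBall_symm
  have hψm : ∀ x, ψ x ∈ ball (0 : F) r := fun x ↦ by
    have := ψ.map_source (x := x) (by simp [hψ])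
    rwa [hψ, OpenPartialHomeomorph.univBall_target _ hr] at this
  have hψi : ∀ x, ψ.symm (ψ x) = x := fun x ↦ ψ.left_inv (by simp [hψ])
  have hψr : ∀ x ∈ ball (0 : F) r, ψ (ψ.symm x) = x := fun x hx ↦
    ψ.right_inv (by rwa [hψ, OpenPartialHomeomorph.univBall_target _ hr])
  have hdψ : ∀ x, HasFDerivAt ψ (fderiv ℝ ψ x) x := fun x ↦
    (hψs.differentiable (by simp) x).hasFDerivAt
  have hdψ' : ∀ x, HasFDerivAt ψ.symm (fderiv ℝ ψ.symm (ψ x)) (ψ x) := fun x ↦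
    ((hψs'.contDiffAt (isOpen_ball.mem_nhds (hψm x))).differentiableAt (by simp)).hasFDerivAt
  have hinv₁ : ∀ x u, fderiv ℝ ψ.symm (ψ x) (fderiv ℝ ψ x u) = u := by
    intro x u
    have h := ((hdψ' x).comp x (hdψ x)).congr_of_eventuallyEq
      (Filter.Eventually.of_forall fun z ↦ (hψi z).symm : (id : F → F) =ᶠ[𝓝 x] _)
    exact DFunLike.congr_fun (h.unique (hasFDerivAt_id x)) u
  have hinv₂ : ∀ x u, fderiv ℝ ψ x (fderiv ℝ ψ.symm (ψ x) u) = u := by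
    intro x u
    have h1 : HasFDerivAt ψ (fderiv ℝ ψ x) (ψ.symm (ψ x)) := by rw [hψi]; exact hdψ x
    have h := (h1.comp (ψ x) (hdψ' x)).congr_of_eventuallyEq
      (Filter.eventuallyEq_of_mem (isOpen_ball.mem_nhds (hψm x))
        fun z hz ↦ (hψr z hz).symm : (id : F → F) =ᶠ[𝓝 (ψ x)] _)
    exact DFunLike.congr_fun (h.unique (hasFDerivAt_id _)) u
  have hdg : ∀ x, HasFDerivAt (fun x ↦ f (ψ x)) ((s (f (ψ x))).comp (fderiv ℝ ψ x)) x := fun x ↦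
    ((hf _ (hψm x)).2).comp x (hdψ x)
  refine ⟨fun x ↦ f (ψ x), fun x ↦ (fderiv ℝ ψ.symm (ψ x)).comp l, ?_, ?_, ?_, ?_,
    fun x ↦ (hf _ (hψm x)).1, fun x u ↦ ?_, fun x ↦ ?_⟩
  · rw [← contDiffOn_univ]
    exact hfs.comp hψs.contDiffOn fun x _ ↦ hψm x
  · refine ContDiff.clm_comp ?_ contDiff_const
    rw [← contDiffOn_univ]
    exact (hψs'.fderiv_of_isOpen isOpen_ball (m := ∞) (by simp)).comp hψs.contDiffOn
      fun x _ ↦ hψm x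
  · simp [hψ, hf0]
  -- Injectivity: `l ∘ f - id` has zero derivative on the ball, so `f` is injective there.
  · have hconst : ∀ x ∈ ball (0 : F) r, ∀ y ∈ ball (0 : F) r, l (f x) - x = l (f y) - y := by
      have hd : ∀ x ∈ ball (0 : F) r, HasFDerivAt (fun x ↦ l (f x) - x) (0 : F →L[ℝ] F) x := by
        intro x hx
        have h := (l.hasFDerivAt.comp x (hf x hx).2).sub (hasFDerivAt_id x)
        refine h.congr_fderiv ?_
        ext1 u
        simp [hl _ (hf x hx).1]
      intro x hx y hy
      exact (convex_ball (0 : F) r).is_const_of_fderivWithin_eq_zero (𝕜 := ℝ)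
        (fun z hz ↦ (hd z hz).differentiableAt.differentiableWithinAt)
        (fun z hz ↦ ((hd z hz).hasFDerivWithinAt).fderivWithin
          (isOpen_ball.uniqueDiffWithinAt hz)) hx hy
    intro x y hxy
    have h := hconst _ (hψm x) _ (hψm y)
    have hxy' : f (ψ x) = f (ψ y) := hxy
    rw [hxy', sub_right_inj] at h
    rw [← hψi x, h, hψi]
  · rw [(hdg x).fderiv]
    simp [hl _ (hf _ (hψm x)).1, hinv₁]
  · rw [(hdg x).fderiv]
    apply le_antisymm
    · rintro _ ⟨u, rfl⟩
      exact ⟨fderiv ℝ ψ x u, rfl⟩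
    · rintro _ ⟨u, rfl⟩
      exact ⟨fderiv ℝ ψ.symm (ψ x) u, by simp [hinv₂]⟩

set_option synthInstance.maxHeartbeats 200000 in
/-- Integral manifolds of the characteristic distribution of a one-form of constant class. -/
theorem exists_integral_immersion_localCharacteristic [FiniteDimensional ℝ E] {V : Set E}
    (hV : IsOpen V) {a : E → E →L[ℝ] ℝ} (ha : ContDiffOn ℝ ∞ a V) {m : ℕ}
    (hm : ∀ y ∈ V, Module.finrank ℝ (localCharacteristic a y) = m) {y₀ : E} (hy₀ : y₀ ∈ V) :
    ∃ (g : EuclideanSpace ℝ (Fin m) → E)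
      (q : EuclideanSpace ℝ (Fin m) → E →L[ℝ] EuclideanSpace ℝ (Fin m)),
      ContDiff ℝ ∞ g ∧ ContDiff ℝ ∞ q ∧ g 0 = y₀ ∧ Function.Injective g ∧ (∀ x, g x ∈ V) ∧
      (∀ x u, q x (fderiv ℝ g x u) = u) ∧
      ∀ x, LinearMap.range (fderiv ℝ g x).toLinearMap = localCharacteristic a (g x) := by
  have := FiniteDimensional.complete ℝ E
  set K : E → E →L[ℝ] ℝ × (E →L[ℝ] ℝ) := fun y ↦
    (a y).prod (fderiv ℝ a y - (fderiv ℝ a y).flip) with hK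
  have hker : ∀ y, LinearMap.ker (K y).toLinearMap = localCharacteristic a y := fun y ↦ by
    ext v
    simp [hK, localCharacteristic]
  have hda : ContDiffOn ℝ ∞ (fderiv ℝ a) V := ha.fderiv_of_isOpen hV (by simp)
  have hKs : ContDiffOn ℝ ∞ K V := by
    have h1 : ContDiffOn ℝ ∞ (fun y ↦ (fderiv ℝ a y).flip) V :=
      ContDiff.comp_contDiffOn (g := ContinuousLinearMap.flip) (IsBoundedLinearMap.contDiff
        ⟨⟨fun _ _ ↦ rfl, fun _ _ ↦ rfl⟩, 1, one_pos, fun f ↦ by rw [f.opNorm_flip, one_mul]⟩) hda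
    exact ((ContinuousLinearMap.inl ℝ ℝ (E →L[ℝ] ℝ)).postcomp E).contDiff.comp_contDiffOn ha |>.add
      (((ContinuousLinearMap.inr ℝ ℝ (E →L[ℝ] ℝ)).postcomp E).contDiff.comp_contDiffOn
        (hda.sub h1)) |>.congr fun y _ ↦ by ext v <;> simp [hK]
  obtain ⟨U, hUV, hU, hy₀U, s, l, hs, hsl⟩ := exists_local_frame hV hKs
    (fun y hy ↦ by rw [hker, hm y hy]) hy₀
  have hmem : ∀ y ∈ U, ∀ u, s y u ∈ localCharacteristic a y := fun y hy u ↦ by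
    rw [← hker, ← (hsl y hy).2]
    exact ⟨u, rfl⟩
  obtain ⟨g, q, hg, hq, h0, hinj, hgU, hqg, hrange⟩ := exists_integral_immersion hU hs
    (fun y hy ↦ (hsl y hy).1) (fun y hy u w ↦ by
      have h := bracket_mem_localCharacteristic
        ((ha.contDiffAt (hV.mem_nhds (hUV hy))).of_le two_le_infty)
        ((hs.contDiffAt (hU.mem_nhds hy)).differentiableAt (by simp))
        (Filter.eventually_of_mem (hU.mem_nhds hy) hmem) u w
      rw [← hker, ← (hsl y hy).2] at h
      obtain ⟨z, hz⟩ := h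
      exact ⟨z, hz.symm⟩) hy₀U
  exact ⟨g, q, hg, hq, h0, hinj, fun x ↦ hUV (hgU x), hqg, fun x ↦ by
    rw [hrange, (hsl _ (hgU x)).2, hker]⟩

end Distribution
end ContactPairs

end

/-! ### Nijenhuis tensor and normality on a vector space. -/

noncomputable section

open Filter Topology

namespace ContactPairs

section VectorSpace

variable {E : Type*} [NormedAddCommGroup E] [NormedSpace ℝ E]

/-- The Nijenhuis tensor in a vector space is tensorial. -/
lemma nijenhuis_eq_nijenhuisJet {A : E → E →L[ℝ] E} {A' : E →L[ℝ] E →L[ℝ] E} {X Y : E → E} {p : E}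
    (hA : HasFDerivAt A A' p) (hX : DifferentiableAt ℝ X p) (hY : DifferentiableAt ℝ Y p) :
    A p (A p (lieBracket ℝ X Y p)) + lieBracket ℝ (fun y ↦ A y (X y)) (fun y ↦ A y (Y y)) p
      - A p (lieBracket ℝ (fun y ↦ A y (X y)) Y p) - A p (lieBracket ℝ X (fun y ↦ A y (Y y)) p) =
      nijenhuisJet (A p) A' (X p) (Y p) := by
  simp only [lieBracket, (hA.clm_apply hX.hasFDerivAt).fderiv, (hA.clm_apply hY.hasFDerivAt).fderiv,
    nijenhuisJet]
  simp only [map_sub, map_add, _root_.add_apply, ContinuousLinearMap.comp_apply,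
    ContinuousLinearMap.flip_apply]
  abel

end VectorSpace

section Product

variable {F : Type*} [NormedAddCommGroup F] [NormedSpace ℝ F]

/-- The model and the atlas are variables because those of the product `F × ℝ` are equal to, but not
literally, those of a vector space. -/
lemma mlieBracket_self_of_eq {W : Type*} [NormedAddCommGroup W] [NormedSpace ℝ W]
    {I : ModelWithCorners ℝ W W} {c : ChartedSpace W W} (hI : I = 𝓘(ℝ, W))
    (hc : c = chartedSpaceSelf W) (X Y : W → W) (p : W) :
    mlieBracket I (M := W) X Y p = lieBracket ℝ X Y p := by
  subst hI hc
  exact (congrFun (mlieBracketWithin_eq_lieBracketWithin (V := X) (W := Y) (s := univ)) p).trans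
    (congrFun lieBracketWithin_univ p)

lemma smoothVectorField_self_of_eq {W : Type*} [NormedAddCommGroup W] [NormedSpace ℝ W]
    {I : ModelWithCorners ℝ W W} {c : ChartedSpace W W} (hI : I = 𝓘(ℝ, W))
    (hc : c = chartedSpaceSelf W) (hm : IsManifold I 1 W) {X : W → W} (hX : ContDiff ℝ ∞ X) :
    SmoothVectorField I (M := W) X := by
  subst hI hc
  exact contMDiff_vectorSpace_iff_contDiff.2 hX

lemma mlieBracket_prod_self (X Y : F × ℝ → F × ℝ) (p : F × ℝ) :
    mlieBracket (𝓘(ℝ, F).prod 𝓘(ℝ, ℝ)) (M := F × ℝ) X Y p = lieBracket ℝ X Y p :=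
  mlieBracket_self_of_eq modelWithCornersSelf_prod.symm chartedSpaceSelf_prod X Y p

lemma smoothVectorField_prod_self {X : F × ℝ → F × ℝ} (hX : ContDiff ℝ ∞ X) :
    SmoothVectorField (𝓘(ℝ, F).prod 𝓘(ℝ, ℝ)) (M := F × ℝ) X :=
  have hm : IsManifold (𝓘(ℝ, F).prod 𝓘(ℝ, ℝ)) 1 (F × ℝ) := inferInstance
  smoothVectorField_self_of_eq modelWithCornersSelf_prod.symm chartedSpaceSelf_prod hm hX

/-- First-order consequences of the normality of an almost contact structure on a vector space. -/
lemma IsNormal.jets {a : F → F →L[ℝ] ℝ} {Z : F → F} {φ : F → F →L[ℝ] F}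
    (h : IsNormal 𝓘(ℝ, F) (fun x ↦ (a x : TangentSpace 𝓘(ℝ, F) x →L[ℝ] ℝ)) Z φ) {x : F}
    {da : F →L[ℝ] F →L[ℝ] ℝ} {dZ : F →L[ℝ] F} {dφ : F →L[ℝ] F →L[ℝ] F}
    (ha : HasFDerivAt a da x) (hZ : HasFDerivAt Z dZ x) (hφ : HasFDerivAt φ dφ x) :
    (∀ u w, da (φ x u) w - da (φ x w) u + a x (dφ w u) - a x (dφ u w) = 0) ∧
      ∀ u, dφ (Z x) u + φ x (dZ u) - dZ (φ x u) = 0 := by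
  let A : F × ℝ → F × ℝ →L[ℝ] F × ℝ := fun p ↦
    ((φ p.1).comp (ContinuousLinearMap.fst ℝ F ℝ)
      - (ContinuousLinearMap.snd ℝ F ℝ).smulRight (Z p.1)).prod
    ((a p.1).comp (ContinuousLinearMap.fst ℝ F ℝ))
  have hfst : HasFDerivAt (Prod.fst : F × ℝ → F) (ContinuousLinearMap.fst ℝ F ℝ) (x, (0 : ℝ)) :=
    hasFDerivAt_fst
  have ha1 : HasFDerivAt (fun p : F × ℝ ↦ a p.1) _ (x, (0 : ℝ)) := HasFDerivAt.comp _ ha hfst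
  have hZ1 : HasFDerivAt (fun p : F × ℝ ↦ Z p.1) _ (x, (0 : ℝ)) := HasFDerivAt.comp _ hZ hfst
  have hφ1 : HasFDerivAt (fun p : F × ℝ ↦ φ p.1) _ (x, (0 : ℝ)) := HasFDerivAt.comp _ hφ hfst
  obtain ⟨A', hA⟩ : ∃ A', HasFDerivAt A A' (x, (0 : ℝ)) := by
    have hd : DifferentiableAt ℝ A (x, (0 : ℝ)) := by
      have h1 := hφ1.differentiableAt.clm_comp
        (differentiableAt_const (ContinuousLinearMap.fst ℝ F ℝ))
      have h2 : DifferentiableAt ℝ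
          (fun p : F × ℝ ↦ (ContinuousLinearMap.snd ℝ F ℝ).smulRight (Z p.1)) (x, (0 : ℝ)) :=
        ((ContinuousLinearMap.smulRightL ℝ (F × ℝ) F
          (ContinuousLinearMap.snd ℝ F ℝ)).differentiableAt).comp _ hZ1.differentiableAt
      have h3 := ha1.differentiableAt.clm_comp
        (differentiableAt_const (ContinuousLinearMap.fst ℝ F ℝ))
      have h4 := ((differentiableAt_const (ContinuousLinearMap.inl ℝ F ℝ)).clm_comp
        (h1.sub h2)).add ((differentiableAt_const (ContinuousLinearMap.inr ℝ F ℝ)).clm_comp h3)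
      refine h4.congr_of_eventuallyEq (Filter.Eventually.of_forall fun p ↦ ?_)
      ext v <;> simp [A]
    exact ⟨_, hd.hasFDerivAt⟩
  have hA' : ∀ v t u c, A' (v, t) (u, c) = (dφ v u - c • dZ v, da v u) := by
    intro v t u c
    have h1 := hA.clm_apply (hasFDerivAt_const (u, c) (x, (0 : ℝ)))
    have h2 : HasFDerivAt (fun p : F × ℝ ↦ A p (u, c)) _ (x, (0 : ℝ)) :=
      (((hφ1.clm_apply (hasFDerivAt_const u (x, (0 : ℝ)))).sub (hZ1.const_smul c)).prodMk
        (ha1.clm_apply (hasFDerivAt_const u (x, (0 : ℝ)))))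
    have h3 := DFunLike.congr_fun (h1.unique h2) (v, t)
    simpa using h3
  have hN : ∀ v w, nijenhuisJet (A (x, 0)) A' v w = 0 := by
    intro v w
    have h1 := h (fun _ ↦ v) (fun _ ↦ w) (smoothVectorField_prod_self contDiff_const)
      (smoothVectorField_prod_self contDiff_const) (x, (0 : ℝ))
    have h2 := nijenhuis_eq_nijenhuisJet hA (differentiableAt_const v) (differentiableAt_const w)
    simp only [← mlieBracket_prod_self] at h2
    rw [← h2]
    exact h1
  -- The pair (u, 0), (w, 0), in its `ℝ` component, gives the condition on the one-form. The pair
  -- (u, 0), d/dt, in its `F` component, says that the Lie derivative of φ along Z vanishes.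
  constructor
  · intro u w
    have := congrArg Prod.snd (hN (u, 0) (w, 0))
    simpa [nijenhuisJet, A, hA'] using this
  · intro u
    have := congrArg Prod.fst (hN (u, 0) (0, 1))
    simp [nijenhuisJet, A, hA'] at this
    rw [← this]
    abel

end Product
end ContactPairs

end

/-! ### From normality on a leaf to ambient derivatives. -/

noncomputable section

open Filter Topology

namespace ContactPairs

section Pushforward

variable {E : Type*} [NormedAddCommGroup E] [NormedSpace ℝ E]
  {F : Type*} [NormedAddCommGroup F] [NormedSpace ℝ F]

set_option synthInstance.maxHeartbeats 200000 in
/-- The normality of an almost contact structure on an immersed vector space, in terms of the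
first derivatives of ambient fields. -/
lemma IsNormal.ambient_jets {g : F → E} {Z' : F → F} {φ' : F → F →L[ℝ] F} {a : E → E →L[ℝ] ℝ}
    {Z : E → E} {φ : E → E →L[ℝ] E}
    (h : IsNormal 𝓘(ℝ, F)
      (fun x ↦ ((a (g x)).comp (fderiv ℝ g x) : TangentSpace 𝓘(ℝ, F) x →L[ℝ] ℝ)) Z' φ')
    (hg : ContDiff ℝ ∞ g)
    (hZg : ∀ x, fderiv ℝ g x (Z' x) = Z (g x))
    (hφg : ∀ x u, fderiv ℝ g x (φ' x u) = φ (g x) (fderiv ℝ g x u)) {x : F}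
    (hZ' : DifferentiableAt ℝ Z' x) (hφ' : DifferentiableAt ℝ φ' x)
    {da : E →L[ℝ] E →L[ℝ] ℝ} {dZ : E →L[ℝ] E} {dφ : E →L[ℝ] E →L[ℝ] E}
    (ha : HasFDerivAt a da (g x)) (hZ : HasFDerivAt Z dZ (g x)) (hφ : HasFDerivAt φ dφ (g x))
    (haφ : ∀ v, a (g x) (φ (g x) v) = 0)
    (hdaφ : ∀ v w, a (g x) (dφ v w) = -da v (φ (g x) w)) :
    (∀ u w, (da (φ (g x) (fderiv ℝ g x u)) (fderiv ℝ g x w)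
        - da (fderiv ℝ g x w) (φ (g x) (fderiv ℝ g x u)))
      + (da (fderiv ℝ g x u) (φ (g x) (fderiv ℝ g x w))
        - da (φ (g x) (fderiv ℝ g x w)) (fderiv ℝ g x u)) = 0) ∧
      ∀ u, dZ (φ (g x) (fderiv ℝ g x u)) - dφ (Z (g x)) (fderiv ℝ g x u)
        - φ (g x) (dZ (fderiv ℝ g x u)) = 0 := by
  have hg1 : HasFDerivAt g (fderiv ℝ g x) x := (hg.differentiable (by simp) x).hasFDerivAt
  have hg2 : HasFDerivAt (fderiv ℝ g) (fderiv ℝ (fderiv ℝ g) x) x :=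
    ((hg.fderiv_right (m := ∞) (by simp)).differentiable (by simp) x).hasFDerivAt
  have hsymm : ∀ v w, fderiv ℝ (fderiv ℝ g) x v w = fderiv ℝ (fderiv ℝ g) x w v :=
    (hg.contDiffAt (x := x)).isSymmSndFDerivAt (by simpa using two_le_infty)
  set d := fderiv ℝ g x with hd
  set d2 := fderiv ℝ (fderiv ℝ g) x with hd2
  have hag : HasFDerivAt (fun x ↦ a (g x)) (da.comp d) x := ha.comp x hg1
  have hZc : HasFDerivAt (fun x ↦ Z (g x)) (dZ.comp d) x := hZ.comp x hg1
  have hφc : HasFDerivAt (fun x ↦ φ (g x)) (dφ.comp d) x := hφ.comp x hg1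
  have ha' := hag.clm_comp hg2
  obtain ⟨n2, n3⟩ := IsNormal.jets (a := fun x ↦ (a (g x)).comp (fderiv ℝ g x)) h ha'
    hZ'.hasFDerivAt hφ'.hasFDerivAt
  -- `r1` and `r2` differentiate the relations that intertwine the induced fields with the ambient
  -- ones. The second derivatives of `g` that appear are symmetric and cancel in the end.
  have r1 : ∀ v, d2 v (Z' x) + d (fderiv ℝ Z' x v) = dZ (d v) := by
    intro v
    have h1 := (hg2.clm_apply hZ'.hasFDerivAt).congr_of_eventuallyEq
      (Filter.Eventually.of_forall fun x ↦ (hZg x).symm)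
    have := DFunLike.congr_fun (h1.unique hZc) v
    simp only [_root_.add_apply, ContinuousLinearMap.comp_apply,
      ContinuousLinearMap.flip_apply] at this
    rw [← this, add_comm]
  have r2 : ∀ v u, d2 v (φ' x u) + d (fderiv ℝ φ' x v u) =
      dφ (d v) (d u) + φ (g x) (d2 v u) := by
    intro v u
    have hu := hasFDerivAt_const (𝕜 := ℝ) u x
    have h1 := (hg2.clm_apply (hφ'.hasFDerivAt.clm_apply hu)).congr_of_eventuallyEq
      (Filter.Eventually.of_forall fun x ↦ (hφg x u).symm)
    have := DFunLike.congr_fun (h1.unique (hφc.clm_apply (hg2.clm_apply hu))) v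
    simp at this
    rw [add_comm, this, add_comm]
  constructor
  · intro u w
    have e := n2 u w
    have f1 := congrArg (a (g x)) (r2 w u)
    have f2 := congrArg (a (g x)) (r2 u w)
    simp only [map_add, haφ, hdaφ, add_zero] at f1 f2
    simp at e
    rw [← hd] at e
    rw [hsymm u] at f2
    rw [hsymm w] at f1
    rw [← hφg, ← hφg]
    rw [← hφg] at f1 f2
    linarith
  · intro u
    have e := congrArg d (n3 u)
    rw [map_zero, map_sub, map_add, hφg] at e
    have f1 := r2 (Z' x) u
    have f2 := congrArg (φ (g x)) (r1 u)
    have f3 := r1 (φ' x u)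
    rw [map_add] at f2
    rw [hφg, hsymm] at f3
    rw [hZg, hsymm (Z' x) u] at f1
    rw [← f2, ← f3]
    linear_combination (norm := module) f1 - e

end Pushforward
end ContactPairs

end

/-! ### Tensor fields read in charts. -/

noncomputable section

namespace ContactPairs

section Charts

variable {E : Type*} [NormedAddCommGroup E] [NormedSpace ℝ E]
  {M : Type*} [TopologicalSpace M] [ChartedSpace E M]

/-- The derivative at `p` of the preferred chart at `x₀`, with the tangent space at `p` identified
with the model space. -/
def chartDeriv (x₀ p : M) : E →L[ℝ] E :=
  mfderiv 𝓘(ℝ, E) 𝓘(ℝ, E) (extChartAt 𝓘(ℝ, E) x₀) p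

/-- The derivative at `y` of the inverse of the preferred chart at `x₀`. -/
def chartSymmDeriv (x₀ : M) (y : E) : E →L[ℝ] E :=
  mfderivWithin 𝓘(ℝ, E) 𝓘(ℝ, E) (extChartAt 𝓘(ℝ, E) x₀).symm (range 𝓘(ℝ, E)) y

/-- A one-form read in the chart at `x₀`. -/
def localForm (α : M → E →L[ℝ] ℝ) (x₀ : M) (y : E) : E →L[ℝ] ℝ :=
  (α ((extChartAt 𝓘(ℝ, E) x₀).symm y)).comp (chartSymmDeriv x₀ y)

/-- A vector field read in the chart at `x₀`. -/
def localField (X : M → E) (x₀ : M) (y : E) : E :=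
  chartDeriv x₀ ((extChartAt 𝓘(ℝ, E) x₀).symm y) (X ((extChartAt 𝓘(ℝ, E) x₀).symm y))

/-- A field of endomorphisms read in the chart at `x₀`. -/
def localEnd (A : M → E →L[ℝ] E) (x₀ : M) (y : E) : E →L[ℝ] E :=
  (chartDeriv x₀ ((extChartAt 𝓘(ℝ, E) x₀).symm y)).comp
    ((A ((extChartAt 𝓘(ℝ, E) x₀).symm y)).comp (chartSymmDeriv x₀ y))

theorem chartDeriv_self [IsManifold 𝓘(ℝ, E) ∞ M] (x : M) :
    chartDeriv x x = ContinuousLinearMap.id ℝ E :=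
  mfderiv_extChartAt_self

variable {x₀ : M} {y : E}

theorem chartDeriv_chartSymmDeriv [IsManifold 𝓘(ℝ, E) ∞ M]
    (hy : y ∈ (extChartAt 𝓘(ℝ, E) x₀).target) (v : E) :
    chartDeriv x₀ ((extChartAt 𝓘(ℝ, E) x₀).symm y) (chartSymmDeriv x₀ y v) = v :=
  DFunLike.congr_fun (mfderiv_extChartAt_comp_mfderivWithin_extChartAt_symm hy) v

theorem chartSymmDeriv_chartDeriv [IsManifold 𝓘(ℝ, E) ∞ M]
    (hy : y ∈ (extChartAt 𝓘(ℝ, E) x₀).target) (v : E) :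
    chartSymmDeriv x₀ y (chartDeriv x₀ ((extChartAt 𝓘(ℝ, E) x₀).symm y) v) = v :=
  DFunLike.congr_fun (mfderivWithin_extChartAt_symm_comp_mfderiv_extChartAt hy) v

theorem chartSymmDeriv_self [IsManifold 𝓘(ℝ, E) ∞ M] (x : M) :
    chartSymmDeriv x (extChartAt 𝓘(ℝ, E) x x) = ContinuousLinearMap.id ℝ E :=
  mfderivWithin_range_extChartAt_symm

theorem isOpen_target (x₀ : M) : IsOpen (extChartAt 𝓘(ℝ, E) x₀).target := by
  simpa using isOpen_extChartAt_target (I := 𝓘(ℝ, E)) x₀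

theorem localForm_localField [IsManifold 𝓘(ℝ, E) ∞ M]
    (hy : y ∈ (extChartAt 𝓘(ℝ, E) x₀).target) (α : M → E →L[ℝ] ℝ) (X : M → E) :
    localForm α x₀ y (localField X x₀ y) =
      α ((extChartAt 𝓘(ℝ, E) x₀).symm y) (X ((extChartAt 𝓘(ℝ, E) x₀).symm y)) := by
  simp only [localForm, localField, ContinuousLinearMap.comp_apply,
    chartSymmDeriv_chartDeriv hy]

theorem localEnd_localField [IsManifold 𝓘(ℝ, E) ∞ M]
    (hy : y ∈ (extChartAt 𝓘(ℝ, E) x₀).target) (A : M → E →L[ℝ] E) (X : M → E) :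
    localEnd A x₀ y (localField X x₀ y) = localField (fun x ↦ A x (X x)) x₀ y := by
  simp only [localEnd, localField, ContinuousLinearMap.comp_apply,
    chartSymmDeriv_chartDeriv hy]

theorem localForm_apply_of_mem_source [IsManifold 𝓘(ℝ, E) ∞ M] {p : M}
    (hp : p ∈ (extChartAt 𝓘(ℝ, E) x₀).source) (α : M → E →L[ℝ] ℝ) :
    (localForm α x₀ (extChartAt 𝓘(ℝ, E) x₀ p)).comp (chartDeriv x₀ p) = α p := by
  have h := (extChartAt 𝓘(ℝ, E) x₀).left_inv hp
  ext v
  have := chartSymmDeriv_chartDeriv ((extChartAt 𝓘(ℝ, E) x₀).map_source hp) v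
  rw [h] at this
  simp only [localForm, ContinuousLinearMap.comp_apply, this, h]

/-! ### Smoothness of the local expressions -/

/-- The trivialization of the tangent bundle at `x₀` acts on fibres by the derivative of the chart,
so the local expression is the section read in it. The one-form and endomorphism cases use the
induced trivializations of the bundles of homomorphisms. -/
theorem SmoothVectorField.contDiffOn_localField [IsManifold 𝓘(ℝ, E) ∞ M]
    {X : Π x : M, TangentSpace 𝓘(ℝ, E) x} (hX : SmoothVectorField 𝓘(ℝ, E) X) (x₀ : M) :
    ContDiffOn ℝ ∞ (localField X x₀) (extChartAt 𝓘(ℝ, E) x₀).target := by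
  have h := ((trivializationAt E (TangentSpace 𝓘(ℝ, E)) x₀).contMDiffOn_section_baseSet_iff
    (IB := 𝓘(ℝ, E)) (n := ∞) (s := X)).1 (ContMDiff.contMDiffOn hX)
  have h2 := h.comp (contMDiffOn_extChartAt_symm (I := 𝓘(ℝ, E)) (n := ∞) x₀) (fun y hy ↦ by
    simpa using (extChartAt 𝓘(ℝ, E) x₀).map_target hy)
  refine (contMDiffOn_iff_contDiffOn.1 h2).congr fun y hy ↦ ?_
  have hs : (extChartAt 𝓘(ℝ, E) x₀).symm y ∈ (chartAt E x₀).source := by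
    simpa using (extChartAt 𝓘(ℝ, E) x₀).map_target hy
  have := TangentBundle.continuousLinearMapAt_trivializationAt (I := 𝓘(ℝ, E)) hs
  have := DFunLike.congr_fun this (X ((extChartAt 𝓘(ℝ, E) x₀).symm y))
  refine Eq.trans this.symm ?_
  simp only [Function.comp]
  rw [Trivialization.continuousLinearMapAt_apply, Trivialization.linearMapAt_apply, if_pos]
  simpa using hs

theorem SmoothOneForm.contDiffOn_localForm [IsManifold 𝓘(ℝ, E) ∞ M]
    {α : Π x : M, TangentSpace 𝓘(ℝ, E) x →L[ℝ] ℝ} (hα : SmoothOneForm 𝓘(ℝ, E) α) (x₀ : M) :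
    ContDiffOn ℝ ∞ (localForm α x₀) (extChartAt 𝓘(ℝ, E) x₀).target := by
  have h := ((trivializationAt (E →L[ℝ] ℝ)
    (fun x : M => TangentSpace 𝓘(ℝ, E) x →L[ℝ] Trivial M ℝ x) x₀).contMDiffOn_section_baseSet_iff
    (IB := 𝓘(ℝ, E)) (n := ∞) (s := α)).1 (ContMDiff.contMDiffOn hα)
  have h2 := h.comp (contMDiffOn_extChartAt_symm (I := 𝓘(ℝ, E)) (n := ∞) x₀) (fun y hy ↦ by
    simpa using (extChartAt 𝓘(ℝ, E) x₀).map_target hy)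
  refine (contMDiffOn_iff_contDiffOn.1 h2).congr fun y hy ↦ ?_
  have hs : (extChartAt 𝓘(ℝ, E) x₀).symm y ∈ (chartAt E x₀).source := by
    simpa using (extChartAt 𝓘(ℝ, E) x₀).map_target hy
  have h3 := TangentBundle.symmL_trivializationAt (I := 𝓘(ℝ, E)) hs
  rw [(extChartAt 𝓘(ℝ, E) x₀).right_inv hy] at h3
  simp only [Function.comp]
  rw [hom_trivializationAt_apply]
  simp only [ContinuousLinearMap.inCoordinates, h3]
  have h4 : (trivializationAt ℝ (Trivial M ℝ) x₀).continuousLinearMapAt ℝ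
      ((extChartAt 𝓘(ℝ, E) x₀).symm y) = ContinuousLinearMap.id ℝ ℝ :=
    Trivial.continuousLinearMapAt_trivialization ℝ M ℝ _
  rw [h4]
  rfl

theorem SmoothEndomorphismField.contDiffOn_localEnd [IsManifold 𝓘(ℝ, E) ∞ M]
    {A : Π x : M, TangentSpace 𝓘(ℝ, E) x →L[ℝ] TangentSpace 𝓘(ℝ, E) x}
    (hA : SmoothEndomorphismField 𝓘(ℝ, E) A) (x₀ : M) :
    ContDiffOn ℝ ∞ (localEnd A x₀) (extChartAt 𝓘(ℝ, E) x₀).target := by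
  have h := ((trivializationAt (E →L[ℝ] E)
    (fun x : M => TangentSpace 𝓘(ℝ, E) x →L[ℝ] TangentSpace 𝓘(ℝ, E) x)
      x₀).contMDiffOn_section_baseSet_iff
    (IB := 𝓘(ℝ, E)) (n := ∞) (s := A)).1 (ContMDiff.contMDiffOn hA)
  have h2 := h.comp (contMDiffOn_extChartAt_symm (I := 𝓘(ℝ, E)) (n := ∞) x₀) (fun y hy ↦ by
    simpa using (extChartAt 𝓘(ℝ, E) x₀).map_target hy)
  refine (contMDiffOn_iff_contDiffOn.1 h2).congr fun y hy ↦ ?_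
  have hs : (extChartAt 𝓘(ℝ, E) x₀).symm y ∈ (chartAt E x₀).source := by
    simpa using (extChartAt 𝓘(ℝ, E) x₀).map_target hy
  have h3 := TangentBundle.symmL_trivializationAt (I := 𝓘(ℝ, E)) hs
  have h4 := TangentBundle.continuousLinearMapAt_trivializationAt (I := 𝓘(ℝ, E)) hs
  rw [(extChartAt 𝓘(ℝ, E) x₀).right_inv hy] at h3
  simp only [Function.comp]
  rw [hom_trivializationAt_apply]
  simp only [ContinuousLinearMap.inCoordinates, h3, h4]
  rfl

end Charts
end ContactPairs

end

/-! ### The exterior derivative in an arbitrary chart. -/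

noncomputable section

namespace ContactPairs

section ExteriorDerivative

variable {E : Type*} [NormedAddCommGroup E] [NormedSpace ℝ E]
  {M : Type*} [TopologicalSpace M] [ChartedSpace E M] [IsManifold 𝓘(ℝ, E) ∞ M]
  {x₀ p : M} {y : E}

theorem contDiffAt_transition (hy : y ∈ (extChartAt 𝓘(ℝ, E) x₀).target)
    (hp : (extChartAt 𝓘(ℝ, E) x₀).symm y ∈ (extChartAt 𝓘(ℝ, E) p).source) :
    ContDiffAt ℝ ∞ (extChartAt 𝓘(ℝ, E) p ∘ (extChartAt 𝓘(ℝ, E) x₀).symm) y := by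
  have h := contDiffWithinAt_ext_coord_change (I := 𝓘(ℝ, E)) (n := ∞) p x₀ (y := y)
    ⟨by simpa using hy, by simpa using hp⟩
  rw [ModelWithCorners.range_eq_univ] at h
  exact h.contDiffAt Filter.univ_mem

theorem fderiv_transition (hy : y ∈ (extChartAt 𝓘(ℝ, E) x₀).target)
    (hp : (extChartAt 𝓘(ℝ, E) x₀).symm y ∈ (extChartAt 𝓘(ℝ, E) p).source) :
    fderiv ℝ (extChartAt 𝓘(ℝ, E) p ∘ (extChartAt 𝓘(ℝ, E) x₀).symm) y =
      (chartDeriv p ((extChartAt 𝓘(ℝ, E) x₀).symm y)).comp (chartSymmDeriv x₀ y) := by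
  rw [← mfderiv_eq_fderiv, ← mfderivWithin_univ, ← ModelWithCorners.range_eq_univ 𝓘(ℝ, E)]
  exact mfderiv_comp_mfderivWithin (I' := 𝓘(ℝ, E)) (x := y)
    (mdifferentiableAt_extChartAt (by simpa using hp))
    (mdifferentiableWithinAt_extChartAt_symm hy)
    (by simpa using uniqueMDiffWithinAt_univ 𝓘(ℝ, E))

theorem localForm_eq_pullback (α : M → E →L[ℝ] ℝ)
    (hy : y ∈ (extChartAt 𝓘(ℝ, E) x₀).target)
    (hp : (extChartAt 𝓘(ℝ, E) x₀).symm y ∈ (extChartAt 𝓘(ℝ, E) p).source) :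
    localForm α x₀ y =
      (localForm α p (extChartAt 𝓘(ℝ, E) p ((extChartAt 𝓘(ℝ, E) x₀).symm y))).comp
        (fderiv ℝ (extChartAt 𝓘(ℝ, E) p ∘ (extChartAt 𝓘(ℝ, E) x₀).symm) y) := by
  rw [fderiv_transition hy hp, ← ContinuousLinearMap.comp_assoc,
    localForm_apply_of_mem_source hp]
  rfl

theorem extDeriv_ofSubsingleton {b : E → E →L[ℝ] ℝ} (hb : DifferentiableAt ℝ b y) (v w : E) :
    extDeriv (fun z ↦ ContinuousAlternatingMap.ofSubsingleton ℝ E ℝ (0 : Fin 1) (b z)) y ![v, w] =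
      fderiv ℝ b y v w - fderiv ℝ b y w v := by
  have hd : DifferentiableAt ℝ
      (fun z ↦ ContinuousAlternatingMap.ofSubsingleton ℝ E ℝ (0 : Fin 1) (b z)) y :=
    ((ContinuousAlternatingMap.ofSubsingletonLIE (𝕜 := ℝ) (E := E) (F := ℝ)
      (0 : Fin 1)).differentiableAt).comp y hb
  have hf (u : E) : fderiv ℝ (fun z ↦ b z u) y = (fderiv ℝ b y).flip u := by
    ext s
    rw [fderiv_clm_apply hb (by fun_prop)]
    simp
  rw [extDeriv_apply hd, Fin.sum_univ_two]
  simp [Fin.removeNth, hf, sub_eq_add_neg]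

/-- `extDerivOneForm` uses a different chart at each point, whereas differentiation needs one chart
on a whole neighbourhood. The two agree because the exterior derivative commutes with pullback by
the transition map. -/
theorem extDerivOneForm_chartSymmDeriv {α : Π x : M, TangentSpace 𝓘(ℝ, E) x →L[ℝ] ℝ}
    (hα : SmoothOneForm 𝓘(ℝ, E) α) (hy : y ∈ (extChartAt 𝓘(ℝ, E) x₀).target) (v w : E) :
    extDerivOneForm 𝓘(ℝ, E) α ((extChartAt 𝓘(ℝ, E) x₀).symm y)
        ![chartSymmDeriv x₀ y v, chartSymmDeriv x₀ y w] =
      fderiv ℝ (localForm α x₀) y v w - fderiv ℝ (localForm α x₀) y w v := by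
  set p := (extChartAt 𝓘(ℝ, E) x₀).symm y with hp
  set t := extChartAt 𝓘(ℝ, E) p ∘ (extChartAt 𝓘(ℝ, E) x₀).symm with ht
  have hps : p ∈ (extChartAt 𝓘(ℝ, E) p).source := mem_extChartAt_source p
  have hdiff (x : M) {z : E} (hz : z ∈ (extChartAt 𝓘(ℝ, E) x).target) :
      DifferentiableAt ℝ (localForm α x) z :=
    ((hα.contDiffOn_localForm x).contDiffAt ((isOpen_target x).mem_nhds hz)).differentiableAt
      (by simp)
  have hty : t y ∈ (extChartAt 𝓘(ℝ, E) p).target := (extChartAt 𝓘(ℝ, E) p).map_source hps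
  have hDt : fderiv ℝ t y = chartSymmDeriv x₀ y := by
    rw [ht, fderiv_transition hy hps, ← hp, chartDeriv_self, ContinuousLinearMap.id_comp]
  have hev : ∀ᶠ z in nhds y, ContinuousAlternatingMap.ofSubsingleton ℝ E ℝ (0 : Fin 1)
      (localForm α x₀ z) = (localOneForm 𝓘(ℝ, E) α p (t z)).compContinuousLinearMap
        (fderiv ℝ t z) := by
    have h1 := (isOpen_target x₀).mem_nhds hy
    have h2 := ((continuousOn_extChartAt_symm (I := 𝓘(ℝ, E)) x₀).continuousAt h1).preimage_mem_nhds
      (extChartAt_source_mem_nhds (I := 𝓘(ℝ, E)) p)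
    filter_upwards [h1, h2] with z hz hz'
    rw [localForm_eq_pullback α hz hz']
    rfl
  rw [← extDeriv_ofSubsingleton (hdiff x₀ hy), Filter.EventuallyEq.extDeriv_eq hev,
    extDeriv_pullback (r := ∞) _ (contDiffAt_transition hy hps)
      (by simpa using two_le_infty), hDt]
  · rw [extDerivOneForm, ModelWithCorners.range_eq_univ, extDerivWithin_univ]
    have hid : (mfderiv 𝓘(ℝ, E) 𝓘(ℝ, E) (extChartAt 𝓘(ℝ, E) p) p :
      TangentSpace 𝓘(ℝ, E) p →L[ℝ] E) = ContinuousLinearMap.id ℝ E := chartDeriv_self p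
    rw [hid]
    change extDeriv (localOneForm 𝓘(ℝ, E) α p) (extChartAt 𝓘(ℝ, E) p p)
      ![chartSymmDeriv x₀ y v, chartSymmDeriv x₀ y w] = _
    rw [ContinuousAlternatingMap.compContinuousLinearMap_apply]
    congr 1
    funext i
    fin_cases i <;> rfl
  · exact ((ContinuousAlternatingMap.ofSubsingletonLIE (𝕜 := ℝ) (E := E) (F := ℝ)
      (0 : Fin 1)).differentiableAt).comp
      _ (hdiff p hty)

end ExteriorDerivative
end ContactPairs

end

/-! ### Integrability as a pointwise condition on jets. -/

noncomputable section

namespace ContactPairs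

section Integrability

variable {E : Type*} [NormedAddCommGroup E] [NormedSpace ℝ E]
  {M : Type*} [TopologicalSpace M] [ChartedSpace E M] [IsManifold 𝓘(ℝ, E) ∞ M]
  {x₀ : M} {y : E}

theorem chartSymmDeriv_mem_characteristic {α : Π x : M, TangentSpace 𝓘(ℝ, E) x →L[ℝ] ℝ}
    (hα : SmoothOneForm 𝓘(ℝ, E) α) (hy : y ∈ (extChartAt 𝓘(ℝ, E) x₀).target) {v : E} :
    chartSymmDeriv x₀ y v ∈ characteristic 𝓘(ℝ, E) α ((extChartAt 𝓘(ℝ, E) x₀).symm y) ↔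
      v ∈ localCharacteristic (localForm α x₀) y := by
  rw [mem_localCharacteristic]
  refine and_congr Iff.rfl ⟨fun h w ↦ ?_, fun h w ↦ ?_⟩
  · rw [← extDerivOneForm_chartSymmDeriv hα hy]
    exact h _
  · have := extDerivOneForm_chartSymmDeriv hα hy v
      (chartDeriv x₀ ((extChartAt 𝓘(ℝ, E) x₀).symm y) w)
    exact (congrArg (fun u : E ↦ extDerivOneForm 𝓘(ℝ, E) α ((extChartAt 𝓘(ℝ, E) x₀).symm y)
      ![chartSymmDeriv x₀ y v, u]) (chartSymmDeriv_chartDeriv hy w)).symm.trans (this.trans (h _))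

/-- The derivative of the inverse of a chart, as a linear equivalence. -/
def chartSymmEquiv (hy : y ∈ (extChartAt 𝓘(ℝ, E) x₀).target) : E ≃ₗ[ℝ] E where
  __ := (chartSymmDeriv x₀ y).toLinearMap
  invFun := chartDeriv x₀ ((extChartAt 𝓘(ℝ, E) x₀).symm y)
  left_inv v := chartDeriv_chartSymmDeriv hy v
  right_inv v := chartSymmDeriv_chartDeriv hy v

theorem finrank_localCharacteristic {α : Π x : M, TangentSpace 𝓘(ℝ, E) x →L[ℝ] ℝ}
    (hα : SmoothOneForm 𝓘(ℝ, E) α) (hy : y ∈ (extChartAt 𝓘(ℝ, E) x₀).target) :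
    Module.finrank ℝ (localCharacteristic (localForm α x₀) y) =
      Module.finrank ℝ (characteristic 𝓘(ℝ, E) α ((extChartAt 𝓘(ℝ, E) x₀).symm y)) := by
  let D : Submodule ℝ E := characteristic 𝓘(ℝ, E) α ((extChartAt 𝓘(ℝ, E) x₀).symm y)
  have h : (localCharacteristic (localForm α x₀) y).map (chartSymmEquiv hy).toLinearMap = D := by
    ext w
    rw [Submodule.mem_map]
    constructor
    · rintro ⟨v, hv, rfl⟩
      exact (chartSymmDeriv_mem_characteristic hα hy).2 hv
    · intro hw
      refine ⟨_, (chartSymmDeriv_mem_characteristic hα hy).1 ?_, chartSymmDeriv_chartDeriv hy w⟩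
      rw [chartSymmDeriv_chartDeriv hy w]
      exact hw
  rw [← LinearEquiv.finrank_map_eq (chartSymmEquiv hy), h]
  rfl

/-- The derivative of the preferred chart at its own base point is the identity, so no pullback
remains on the right. -/
theorem mlieBracket_eq_lieBracket_localField (X Y : Π x : M, TangentSpace 𝓘(ℝ, E) x) (x : M) :
    mlieBracket 𝓘(ℝ, E) X Y x =
      lieBracket ℝ (localField X x) (localField Y x) (extChartAt 𝓘(ℝ, E) x x) := by
  have hinv (w : E) : (mfderiv 𝓘(ℝ, E) 𝓘(ℝ, E) (extChartAt 𝓘(ℝ, E) x) x).inverse w = w := by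
    have h := ContinuousLinearMap.inverse_eq
      (mfderiv_extChartAt_comp_mfderivWithin_extChartAt_symm' (I := 𝓘(ℝ, E))
        (mem_extChartAt_source x))
      (mfderivWithin_extChartAt_symm_comp_mfderiv_extChartAt' (I := 𝓘(ℝ, E))
        (mem_extChartAt_source x))
    exact (DFunLike.congr_fun h w).trans (DFunLike.congr_fun (chartSymmDeriv_self x) w)
  have hev (W : Π x : M, TangentSpace 𝓘(ℝ, E) x) :
      mpullbackWithin 𝓘(ℝ, E) 𝓘(ℝ, E) (extChartAt 𝓘(ℝ, E) x).symm W (range 𝓘(ℝ, E))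
        =ᶠ[nhds (extChartAt 𝓘(ℝ, E) x x)] localField W x := by
    filter_upwards [extChartAt_target_mem_nhds (I := 𝓘(ℝ, E)) x] with z hz
    rw [mpullbackWithin_apply, ContinuousLinearMap.inverse_eq
      (mfderivWithin_extChartAt_symm_comp_mfderiv_extChartAt hz)
      (mfderiv_extChartAt_comp_mfderivWithin_extChartAt_symm hz)]
    rfl
  rw [← mlieBracketWithin_univ, mlieBracketWithin_apply]
  refine (hinv _).trans ?_
  rw [preimage_univ, univ_inter]
  have hu := (hev X).lieBracket_vectorField_eq (𝕜 := ℝ) (hev Y)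
  have huniv (V W : E → E) (s : Set E) (hs : s = univ) (y : E) :
      lieBracketWithin ℝ V W s y = lieBracket ℝ V W y := by
    rw [hs, lieBracketWithin_univ]
  exact (huniv _ _ _ (ModelWithCorners.range_eq_univ _) _).trans hu

theorem localField_self (X : M → E) (x : M) :
    localField X x (extChartAt 𝓘(ℝ, E) x x) = X x := by
  rw [localField, extChartAt_to_inv, chartDeriv_self]
  rfl

theorem localEnd_self (A : M → E →L[ℝ] E) (x : M) :
    localEnd A x (extChartAt 𝓘(ℝ, E) x x) = A x := by
  rw [localEnd, extChartAt_to_inv, chartDeriv_self, chartSymmDeriv_self]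
  rfl

theorem nijenhuisJet_localField {A : M → E →L[ℝ] E} {X Y : M → E} {x : M}
    (hA : DifferentiableAt ℝ (localEnd A x) (extChartAt 𝓘(ℝ, E) x x))
    (hX : DifferentiableAt ℝ (localField X x) (extChartAt 𝓘(ℝ, E) x x))
    (hY : DifferentiableAt ℝ (localField Y x) (extChartAt 𝓘(ℝ, E) x x)) :
    A x (A x (lieBracket ℝ (localField X x) (localField Y x) (extChartAt 𝓘(ℝ, E) x x)))
      + lieBracket ℝ (localField (fun z ↦ A z (X z)) x) (localField (fun z ↦ A z (Y z)) x)
        (extChartAt 𝓘(ℝ, E) x x)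
      - A x (lieBracket ℝ (localField (fun z ↦ A z (X z)) x) (localField Y x)
        (extChartAt 𝓘(ℝ, E) x x))
      - A x (lieBracket ℝ (localField X x) (localField (fun z ↦ A z (Y z)) x)
        (extChartAt 𝓘(ℝ, E) x x)) =
      nijenhuisJet (localEnd A x (extChartAt 𝓘(ℝ, E) x x))
        (fderiv ℝ (localEnd A x) (extChartAt 𝓘(ℝ, E) x x)) (X x) (Y x) := by
  have hev (W : M → E) : localField (fun z ↦ A z (W z)) x =ᶠ[nhds (extChartAt 𝓘(ℝ, E) x x)]
      fun z ↦ localEnd A x z (localField W x z) := by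
    filter_upwards [(isOpen_target x).mem_nhds (mem_extChartAt_target x)] with z hz
    exact (localEnd_localField hz A W).symm
  have key := nijenhuis_eq_nijenhuisJet hA.hasFDerivAt hX hY
  rw [localField_self, localField_self, ← (hev X).lieBracket_vectorField_eq (hev Y),
    ← (hev X).lieBracket_vectorField_eq (Filter.EventuallyEq.refl _ (localField Y x)),
    ← (Filter.EventuallyEq.refl _ (localField X x)).lieBracket_vectorField_eq (hev Y)] at key
  rw [← key, localEnd_self]

theorem nijenhuis_eq_nijenhuisJet_localEnd
    {A : Π x : M, TangentSpace 𝓘(ℝ, E) x →L[ℝ] TangentSpace 𝓘(ℝ, E) x} {x : M}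
    (hA : DifferentiableAt ℝ (localEnd A x) (extChartAt 𝓘(ℝ, E) x x))
    {X Y : Π x : M, TangentSpace 𝓘(ℝ, E) x} (hX : SmoothVectorField 𝓘(ℝ, E) X)
    (hY : SmoothVectorField 𝓘(ℝ, E) Y) :
    nijenhuis 𝓘(ℝ, E) A X Y x =
      nijenhuisJet (localEnd A x (extChartAt 𝓘(ℝ, E) x x))
        (fderiv ℝ (localEnd A x) (extChartAt 𝓘(ℝ, E) x x)) (X x) (Y x) := by
  have hdiff {W : Π x : M, TangentSpace 𝓘(ℝ, E) x} (hW : SmoothVectorField 𝓘(ℝ, E) W) :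
      DifferentiableAt ℝ (localField W x) (extChartAt 𝓘(ℝ, E) x x) :=
    ((hW.contDiffOn_localField x).contDiffAt
      ((isOpen_target x).mem_nhds (mem_extChartAt_target x))).differentiableAt (by simp)
  have key := nijenhuisJet_localField (E := E) hA (hdiff hX) (hdiff hY)
  refine Eq.trans ?_ key
  rw [nijenhuis, mlieBracket_eq_lieBracket_localField, mlieBracket_eq_lieBracket_localField,
    mlieBracket_eq_lieBracket_localField, mlieBracket_eq_lieBracket_localField]
  rfl

/-- A local extension of `v` multiplied by a bump function. Globally defined fields thus take all
values at `x`, which integrability, tested on global fields only, requires. -/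
theorem exists_smoothVectorField_apply_eq [FiniteDimensional ℝ E] [T2Space M] (x : M)
    (v : TangentSpace 𝓘(ℝ, E) x) :
    ∃ X : Π x : M, TangentSpace 𝓘(ℝ, E) x, SmoothVectorField 𝓘(ℝ, E) X ∧ X x = v := by
  obtain ⟨s, hs, hsv⟩ := FiberBundle.exists_contMDiffOn_extend (k := ∞) 𝓘(ℝ, E) E
    (V := fun x : M ↦ TangentSpace 𝓘(ℝ, E) x) v
  obtain ⟨u, hus, hu, hxu⟩ := mem_nhds_iff.1 hs
  obtain ⟨f, -, hf⟩ := (SmoothBumpFunction.nhds_basis_tsupport (I := 𝓘(ℝ, E)) x).mem_iff.1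
    (hu.mem_nhds hxu)
  refine ⟨fun z ↦ f z • FiberBundle.extend E v z,
    ContMDiffOn.smul_section_of_tsupport f.contMDiff.contMDiffOn hu hf (hsv.mono hus), ?_⟩
  simp

theorem isIntegrable_iff_nijenhuisJet [FiniteDimensional ℝ E] [T2Space M]
    {A : Π x : M, TangentSpace 𝓘(ℝ, E) x →L[ℝ] TangentSpace 𝓘(ℝ, E) x}
    (hA : ∀ x, DifferentiableAt ℝ (localEnd A x) (extChartAt 𝓘(ℝ, E) x x)) :
    IsIntegrable 𝓘(ℝ, E) A ↔ ∀ (x : M) (v w : E),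
      nijenhuisJet (localEnd A x (extChartAt 𝓘(ℝ, E) x x))
        (fderiv ℝ (localEnd A x) (extChartAt 𝓘(ℝ, E) x x)) v w = 0 := by
  refine ⟨fun h x v w ↦ ?_, fun h X Y hX hY x ↦ ?_⟩
  · obtain ⟨X, hX, rfl⟩ := exists_smoothVectorField_apply_eq x v
    obtain ⟨Y, hY, rfl⟩ := exists_smoothVectorField_apply_eq x w
    exact (nijenhuis_eq_nijenhuisJet_localEnd (hA x) hX hY).symm.trans (h X Y hX hY x)
  · exact (nijenhuis_eq_nijenhuisJet_localEnd (hA x) hX hY).trans (h x _ _)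

end Integrability
end ContactPairs

end

/-! ### Normality of the leaves in local coordinates. -/

noncomputable section

namespace ContactPairs

section Leaves

variable {E : Type*} [NormedAddCommGroup E] [NormedSpace ℝ E]

/-- The derivative of the identity `a ∘ f = 0`. -/
theorem apply_fderiv_of_apply_eq_zero {a : E → E →L[ℝ] ℝ} {f : E → E →L[ℝ] E} {y : E}
    (ha : DifferentiableAt ℝ a y) (hf : DifferentiableAt ℝ f y)
    (h : ∀ᶠ z in nhds y, ∀ v, a z (f z v) = 0) (v w : E) :
    a y (fderiv ℝ f y v w) = -fderiv ℝ a y v (f y w) := by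
  have h1 := ha.hasFDerivAt.clm_apply (hf.hasFDerivAt.clm_apply (hasFDerivAt_const (𝕜 := ℝ) w y))
  have h2 := (hasFDerivAt_const (𝕜 := ℝ) (0 : ℝ) y).congr_of_eventuallyEq (h.mono fun z hz ↦ hz w)
  have := DFunLike.congr_fun (h1.unique h2) v
  simp only [_root_.add_apply, ContinuousLinearMap.comp_apply, ContinuousLinearMap.flip_apply,
    _root_.zero_apply, map_zero, zero_add] at this
  linarith

variable {M : Type*} [TopologicalSpace M] [ChartedSpace E M] [IsManifold 𝓘(ℝ, E) ∞ M]
  {x₀ : M}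

theorem hasMFDerivAt_symm_comp {F : Type*} [NormedAddCommGroup F] [NormedSpace ℝ F] {g : F → E}
    {x : F} (hg : DifferentiableAt ℝ g x) (hx : g x ∈ (extChartAt 𝓘(ℝ, E) x₀).target) :
    HasMFDerivAt 𝓘(ℝ, F) 𝓘(ℝ, E) ((extChartAt 𝓘(ℝ, E) x₀).symm ∘ g) x
      ((chartSymmDeriv (E := E) x₀ (g x)).comp (fderiv ℝ g x) : F →L[ℝ] E) := by
  have h1 := (mdifferentiableWithinAt_extChartAt_symm (I := 𝓘(ℝ, E)) hx).hasMFDerivWithinAt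
  have h2 : HasMFDerivAt 𝓘(ℝ, E) 𝓘(ℝ, E) (extChartAt 𝓘(ℝ, E) x₀).symm (g x)
      (chartSymmDeriv (E := E) x₀ (g x)) :=
    h1.hasMFDerivAt (by rw [ModelWithCorners.range_eq_univ]; exact Filter.univ_mem)
  exact h2.comp x hg.hasFDerivAt.hasMFDerivAt

/-- The left inverse `q` gives the injectivity of the differential, and the chart carries the local
characteristic distribution to the one on `M`. -/
theorem isIntegralManifold_symm_comp {F : Type*} [NormedAddCommGroup F] [NormedSpace ℝ F]
    {β : Π x : M, TangentSpace 𝓘(ℝ, E) x →L[ℝ] ℝ} (hβ : SmoothOneForm 𝓘(ℝ, E) β)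
    {g : F → E} {q : F → E →L[ℝ] F} (hg : ContDiff ℝ ∞ g) (hginj : Function.Injective g)
    (hgt : ∀ x, g x ∈ (extChartAt 𝓘(ℝ, E) x₀).target) (hq : ∀ x u, q x (fderiv ℝ g x u) = u)
    (hrange : ∀ x, LinearMap.range (fderiv ℝ g x).toLinearMap =
      localCharacteristic (localForm β x₀) (g x)) :
    IsIntegralManifold 𝓘(ℝ, E) 𝓘(ℝ, F) (characteristic 𝓘(ℝ, E) β)
      ((extChartAt 𝓘(ℝ, E) x₀).symm ∘ g) := by
  have hmf (x : F) := (hasMFDerivAt_symm_comp (hg.differentiable (by simp) x) (hgt x)).mfderiv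
  refine ⟨?_, ?_, fun x ↦ ?_, fun x ↦ ?_⟩
  · exact (contMDiffOn_extChartAt_symm x₀).comp_contMDiff hg.contMDiff hgt
  · exact fun x y hxy ↦ hginj ((extChartAt 𝓘(ℝ, E) x₀).symm.injOn (hgt x) (hgt y) hxy)
  · rw [hmf]
    intro u w huw
    have h1 := congrArg (chartDeriv (E := E) x₀ ((extChartAt 𝓘(ℝ, E) x₀).symm (g x))) huw
    have h2 := congrArg (q x) ((chartDeriv_chartSymmDeriv (hgt x) _).symm.trans
      (h1.trans (chartDeriv_chartSymmDeriv (hgt x) _)))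
    exact (hq x u).symm.trans (h2.trans (hq x w))
  · rw [hmf]
    have hmem (v : E) : v ∈ LinearMap.range (fderiv ℝ g x).toLinearMap ↔
        chartSymmDeriv x₀ (g x) v ∈
          characteristic 𝓘(ℝ, E) β ((extChartAt 𝓘(ℝ, E) x₀).symm (g x)) := by
      rw [hrange, chartSymmDeriv_mem_characteristic hβ (hgt x)]
    ext v
    constructor
    · rintro ⟨u, rfl⟩
      exact (hmem _).1 ⟨u, rfl⟩
    · intro hv
      have hv' := chartSymmDeriv_chartDeriv (hgt x) v
      obtain ⟨u, hu⟩ := (hmem (chartDeriv x₀ ((extChartAt 𝓘(ℝ, E) x₀).symm (g x)) v)).2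
        (hv'.symm ▸ hv)
      exact ⟨u, (congrArg (chartSymmDeriv x₀ (g x)) hu).trans hv'⟩

set_option synthInstance.maxHeartbeats 200000 in
/-- The normality of the structure induced on the leaves of the characteristic foliation of `β`,
in terms of the first derivatives of the local expressions. -/
theorem LeavesAreNormal.local_jets [FiniteDimensional ℝ E]
    {α β : Π x : M, TangentSpace 𝓘(ℝ, E) x →L[ℝ] ℝ} {Z : Π x : M, TangentSpace 𝓘(ℝ, E) x}
    {φ : Π x : M, TangentSpace 𝓘(ℝ, E) x →L[ℝ] TangentSpace 𝓘(ℝ, E) x}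
    (hα : SmoothOneForm 𝓘(ℝ, E) α) (hβ : SmoothOneForm 𝓘(ℝ, E) β)
    (hZ : SmoothVectorField 𝓘(ℝ, E) Z) (hφ : SmoothEndomorphismField 𝓘(ℝ, E) φ) {m : ℕ}
    (hm : ∀ p, Module.finrank ℝ (characteristic 𝓘(ℝ, E) β p) = m)
    (hZβ : ∀ p, Z p ∈ characteristic 𝓘(ℝ, E) β p)
    (hφβ : ∀ p, ∀ v ∈ characteristic 𝓘(ℝ, E) β p, φ p v ∈ characteristic 𝓘(ℝ, E) β p)
    (hαφ : ∀ p v, α p (φ p v) = 0)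
    (h : LeavesAreNormal 𝓘(ℝ, E) (characteristic 𝓘(ℝ, E) β) α Z φ) {y : E}
    (hy : y ∈ (extChartAt 𝓘(ℝ, E) x₀).target) :
    (∀ v ∈ localCharacteristic (localForm β x₀) y, ∀ w ∈ localCharacteristic (localForm β x₀) y,
      (fderiv ℝ (localForm α x₀) y (localEnd φ x₀ y v) w
          - fderiv ℝ (localForm α x₀) y w (localEnd φ x₀ y v))
        + (fderiv ℝ (localForm α x₀) y v (localEnd φ x₀ y w)
          - fderiv ℝ (localForm α x₀) y (localEnd φ x₀ y w) v) = 0) ∧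
    ∀ v ∈ localCharacteristic (localForm β x₀) y,
      fderiv ℝ (localField Z x₀) y (localEnd φ x₀ y v)
        - fderiv ℝ (localEnd φ x₀) y (localField Z x₀ y) v
        - localEnd φ x₀ y (fderiv ℝ (localField Z x₀) y v) = 0 := by
  have hV := isOpen_target (E := E) x₀
  obtain ⟨g, q, hg, hqs, hg0, hginj, hgt, hq, hrange⟩ :=
    exists_integral_immersion_localCharacteristic hV (hβ.contDiffOn_localForm x₀)
      (fun z hz ↦ (finrank_localCharacteristic hβ hz).trans (hm _)) hy
  have hproj (x : EuclideanSpace ℝ (Fin m)) {v : E}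
      (hv : v ∈ localCharacteristic (localForm β x₀) (g x)) : fderiv ℝ g x (q x v) = v := by
    rw [← hrange] at hv
    obtain ⟨u, rfl⟩ := hv
    exact congrArg (fderiv ℝ g x) (hq x u)
  have hmf (x : EuclideanSpace ℝ (Fin m)) :=
    (hasMFDerivAt_symm_comp (hg.differentiable (by simp) x) (hgt x)).mfderiv
  have hZloc {z : E} (hz : z ∈ (extChartAt 𝓘(ℝ, E) x₀).target) :
      localField Z x₀ z ∈ localCharacteristic (localForm β x₀) z := by
    rw [← chartSymmDeriv_mem_characteristic hβ hz]
    exact (chartSymmDeriv_chartDeriv hz (Z _)).symm ▸ hZβ _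
  have hφloc {z : E} (hz : z ∈ (extChartAt 𝓘(ℝ, E) x₀).target) {v : E}
      (hv : v ∈ localCharacteristic (localForm β x₀) z) :
      localEnd φ x₀ z v ∈ localCharacteristic (localForm β x₀) z := by
    rw [← chartSymmDeriv_mem_characteristic hβ hz] at hv ⊢
    exact (chartSymmDeriv_chartDeriv hz (φ _ (chartSymmDeriv x₀ z v))).symm ▸ hφβ _ _ hv
  have hαφloc {z : E} (hz : z ∈ (extChartAt 𝓘(ℝ, E) x₀).target) (v : E) :
      localForm α x₀ z (localEnd φ x₀ z v) = 0 :=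
    (congrArg (α _) (chartSymmDeriv_chartDeriv hz (φ _ (chartSymmDeriv x₀ z v)))).trans
      (hαφ _ _)
  have hmemg (x : EuclideanSpace ℝ (Fin m)) (u : EuclideanSpace ℝ (Fin m)) :
      fderiv ℝ g x u ∈ localCharacteristic (localForm β x₀) (g x) := by
    rw [← hrange]
    exact ⟨u, rfl⟩
  -- Z and φ preserve the tangent spaces of the leaf, so applying `q` pulls them back to induced
  -- fields, differentiable because `q` is smooth.
  let Z' : EuclideanSpace ℝ (Fin m) → EuclideanSpace ℝ (Fin m) :=
    fun x ↦ q x (localField Z x₀ (g x))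
  let φ' : EuclideanSpace ℝ (Fin m) → EuclideanSpace ℝ (Fin m) →L[ℝ] EuclideanSpace ℝ (Fin m) :=
    fun x ↦ (q x).comp ((localEnd φ x₀ (g x)).comp (fderiv ℝ g x))
  have hZg (x) : fderiv ℝ g x (Z' x) = localField Z x₀ (g x) := hproj x (hZloc (hgt x))
  have hφg (x u) : fderiv ℝ g x (φ' x u) = localEnd φ x₀ (g x) (fderiv ℝ g x u) :=
    hproj x (hφloc (hgt x) (hmemg x u))
  -- The leaf hypothesis is used for `L = ℝ^m` itself, embedded by `g` followed by the inverse of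
  -- the chart.
  have hN := h m (EuclideanSpace ℝ (Fin m)) _
    (isIntegralManifold_symm_comp hβ hg hginj hgt hq hrange) Z' φ'
    (fun x ↦ by
      rw [hmf]
      exact (congrArg (chartSymmDeriv x₀ (g x)) (hZg x)).trans
        (chartSymmDeriv_chartDeriv (hgt x) _))
    (fun x u ↦ by
      rw [hmf]
      exact (congrArg (chartSymmDeriv x₀ (g x)) (hφg x u)).trans
        (chartSymmDeriv_chartDeriv (hgt x) _))
  have hform : (fun x ↦ (α (((extChartAt 𝓘(ℝ, E) x₀).symm ∘ g) x)).comp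
      (mfderiv (𝓡 m) 𝓘(ℝ, E) ((extChartAt 𝓘(ℝ, E) x₀).symm ∘ g) x)) =
      fun x ↦ ((localForm α x₀ (g x)).comp (fderiv ℝ g x) :
        TangentSpace (𝓡 m) x →L[ℝ] ℝ) := by
    funext x
    rw [hmf]
    rfl
  rw [hform] at hN
  have hda := (hα.contDiffOn_localForm x₀).contDiffAt (hV.mem_nhds hy)
  have hdZ := (hZ.contDiffOn_localField x₀).contDiffAt (hV.mem_nhds hy)
  have hdφ := (hφ.contDiffOn_localEnd x₀).contDiffAt (hV.mem_nhds hy)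
  have hda' := hda.differentiableAt (by simp)
  have hdZ' := hdZ.differentiableAt (by simp)
  have hdφ' := hdφ.differentiableAt (by simp)
  subst hg0
  have hg' : DifferentiableAt ℝ g 0 := hg.differentiable (by simp) 0
  have hq' : DifferentiableAt ℝ q 0 := hqs.differentiable (by simp) 0
  have hDg : DifferentiableAt ℝ (fderiv ℝ g) 0 :=
    (hg.fderiv_right (m := ∞) (by simp)).differentiable (by simp) 0
  have hZ'd : DifferentiableAt ℝ Z' 0 := hq'.clm_apply (hdZ'.comp 0 hg')
  have hφ'd : DifferentiableAt ℝ φ' 0 := hq'.clm_comp ((hdφ'.comp 0 hg').clm_comp hDg)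
  obtain ⟨n2, n3⟩ := IsNormal.ambient_jets (a := localForm α x₀) (Z := localField Z x₀)
    (φ := localEnd φ x₀) hN hg hZg hφg hZ'd hφ'd hda'.hasFDerivAt hdZ'.hasFDerivAt
    hdφ'.hasFDerivAt (hαφloc (hgt 0)) (apply_fderiv_of_apply_eq_zero hda' hdφ'
      (Filter.eventually_of_mem (hV.mem_nhds hy) fun z hz v ↦ hαφloc hz v))
  refine ⟨fun v hv w hw ↦ ?_, fun v hv ↦ ?_⟩
  · rw [← hproj 0 hv, ← hproj 0 hw]
    exact n2 _ _
  · rw [← hproj 0 hv]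
    exact n3 _

end Leaves
end ContactPairs

end

/-! ### The jet of a contact pair structure with normal leaves. -/

noncomputable section

namespace ContactPairs

section Jet

variable {E : Type*} [NormedAddCommGroup E] [NormedSpace ℝ E]
  {M : Type*} [TopologicalSpace M] [ChartedSpace E M]

/-- The first derivatives of the local expressions of a contact pair structure. -/
def localJet (α : Bool → M → E →L[ℝ] ℝ) (Z : Bool → M → E) (φ : M → E →L[ℝ] E) (x₀ : M) (y : E) :
    ContactJet E where
  a i := localForm (α i) x₀ y
  da i := fderiv ℝ (localForm (α i) x₀) y
  z i := localField (Z i) x₀ y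
  dz i := fderiv ℝ (localField (Z i) x₀) y
  φ := localEnd φ x₀ y
  dφ := fderiv ℝ (localEnd φ x₀) y

variable {α : Bool → Π x : M, TangentSpace 𝓘(ℝ, E) x →L[ℝ] ℝ}
  {Z : Bool → Π x : M, TangentSpace 𝓘(ℝ, E) x}
  {φ : Π x : M, TangentSpace 𝓘(ℝ, E) x →L[ℝ] TangentSpace 𝓘(ℝ, E) x} {x₀ : M} {y : E}

theorem isChar_localJet_iff (i : Bool) (v : E) :
    (localJet α Z φ x₀ y).IsChar i v ↔ v ∈ localCharacteristic (localForm (α i) x₀) y := by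
  rw [mem_localCharacteristic]
  rfl

/-- The local expression of `φ + ε (α₁ ⊗ Z₂ - α₂ ⊗ Z₁)`. -/
theorem localEnd_cpx {A : Π x : M, TangentSpace 𝓘(ℝ, E) x →L[ℝ] TangentSpace 𝓘(ℝ, E) x} {ε : ℝ}
    (hA : ∀ p v, A p v = φ p v + ε • (α false p v • Z true p - α true p v • Z false p)) (y : E) :
    localEnd A x₀ y = localEnd φ x₀ y + ε •
      ((localForm (α false) x₀ y).smulRight (localField (Z true) x₀ y)
        - (localForm (α true) x₀ y).smulRight (localField (Z false) x₀ y)) := by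
  ext v
  have h1 := congrArg (chartDeriv (E := E) x₀ ((extChartAt 𝓘(ℝ, E) x₀).symm y))
    (hA ((extChartAt 𝓘(ℝ, E) x₀).symm y) (chartSymmDeriv x₀ y v))
  have h3 (L : E →L[ℝ] E) (a b c : E) (s t : ℝ) :
      L (a + ε • (s • b - t • c)) = L a + ε • (s • L b - t • L c) := by
    rw [map_add, map_smul, map_sub, map_smul, map_smul]
  exact h1.trans (h3 (chartDeriv x₀ _) _ _ _ _ _)

variable [IsManifold 𝓘(ℝ, E) ∞ M]

variable (α Z φ) in
/-- A contact pair structure with decomposable endomorphism and normal induced structures, with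
the forms and the Reeb vector fields indexed by the booleans. -/
structure IsNormalPair (d : Bool → ℕ) : Prop where
  smooth_form : ∀ i, SmoothOneForm 𝓘(ℝ, E) (α i)
  smooth_field : ∀ i, SmoothVectorField 𝓘(ℝ, E) (Z i)
  smooth_end : SmoothEndomorphismField 𝓘(ℝ, E) φ
  sq : ∀ p v, φ p (φ p v) = -v + α false p v • Z false p + α true p v • Z true p
  form_field : ∀ i k p, α i p (Z k p) = if i = k then 1 else 0
  contract : ∀ i k p v, extDerivOneForm 𝓘(ℝ, E) (α i) p ![Z k p, v] = 0
  end_field : ∀ k p, φ p (Z k p) = 0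
  isCompl : ∀ p, IsCompl (characteristic 𝓘(ℝ, E) (α false) p)
    (characteristic 𝓘(ℝ, E) (α true) p)
  finrank : ∀ i p, Module.finrank ℝ (characteristic 𝓘(ℝ, E) (α i) p) = d i
  decomposable : ∀ i p, ∀ v ∈ characteristic 𝓘(ℝ, E) (α i) p,
    φ p v ∈ characteristic 𝓘(ℝ, E) (α i) p
  normal : ∀ i, LeavesAreNormal 𝓘(ℝ, E) (characteristic 𝓘(ℝ, E) (α !i)) (α i) (Z i) φ

namespace IsNormalPair

variable {d : Bool → ℕ}

/-- Computing φ³v as φ²(φv) and as φ(φ²v) gives α₁(φv) Z₁ + α₂(φv) Z₂ = 0. -/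
theorem form_end (h : IsNormalPair α Z φ d) (i : Bool) (p : M) (v : TangentSpace 𝓘(ℝ, E) p) :
    α i p (φ p v) = 0 := by
  have h1 := h.sq p (φ p v)
  rw [h.sq p v, map_add, map_add, map_neg, map_smul, map_smul, h.end_field, h.end_field,
    smul_zero, smul_zero, add_zero, add_zero, add_assoc, left_eq_add] at h1
  have h2 := congrArg (α i p) h1
  rw [map_add, map_smul, map_smul, h.form_field, h.form_field, map_zero] at h2
  cases i <;> simpa using h2

theorem field_mem_characteristic (h : IsNormalPair α Z φ d) (i : Bool) (p : M) :
    Z i p ∈ characteristic 𝓘(ℝ, E) (α !i) p :=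
  ⟨by rw [h.form_field]; simp, h.contract _ _ _⟩

theorem localForm_localField_eq (h : IsNormalPair α Z φ d)
    (hy : y ∈ (extChartAt 𝓘(ℝ, E) x₀).target) (i k : Bool) :
    localForm (α i) x₀ y (localField (Z k) x₀ y) = if i = k then 1 else 0 :=
  (localForm_localField hy (α i) (Z k)).trans (h.form_field i k _)

theorem localEnd_localField_eq_zero (h : IsNormalPair α Z φ d)
    (hy : y ∈ (extChartAt 𝓘(ℝ, E) x₀).target) (k : Bool) :
    localEnd φ x₀ y (localField (Z k) x₀ y) = 0 :=
  (localEnd_localField hy φ (Z k)).trans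
    ((congrArg (chartDeriv (E := E) x₀ _) (h.end_field k _)).trans (map_zero _))

theorem localForm_localEnd_eq_zero (h : IsNormalPair α Z φ d)
    (hy : y ∈ (extChartAt 𝓘(ℝ, E) x₀).target) (i : Bool) (v : E) :
    localForm (α i) x₀ y (localEnd φ x₀ y v) = 0 :=
  (congrArg (α i _) (chartSymmDeriv_chartDeriv hy (φ _ (chartSymmDeriv x₀ y v)))).trans
    (h.form_end i _ _)

theorem localEnd_sq (h : IsNormalPair α Z φ d)
    (hy : y ∈ (extChartAt 𝓘(ℝ, E) x₀).target) (v : E) :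
    localEnd φ x₀ y (localEnd φ x₀ y v) =
      -v + localForm (α false) x₀ y v • localField (Z false) x₀ y
        + localForm (α true) x₀ y v • localField (Z true) x₀ y := by
  have h1 := congrArg (chartDeriv (E := E) x₀ ((extChartAt 𝓘(ℝ, E) x₀).symm y))
    ((congrArg (φ ((extChartAt 𝓘(ℝ, E) x₀).symm y))
      (chartSymmDeriv_chartDeriv hy (φ _ (chartSymmDeriv x₀ y v)))).trans
      (h.sq _ (chartSymmDeriv x₀ y v)))
  have h3 (L : E →L[ℝ] E) (a b c : E) (s t : ℝ) :
      L (-a + s • b + t • c) = -L a + s • L b + t • L c := by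
    rw [map_add, map_add, map_neg, map_smul, map_smul]
  refine h1.trans ((h3 (chartDeriv x₀ _) _ _ _ _ _).trans ?_)
  rw [chartDeriv_chartSymmDeriv hy v]
  rfl

theorem differentiableAt_localForm (h : IsNormalPair α Z φ d)
    (hy : y ∈ (extChartAt 𝓘(ℝ, E) x₀).target) (i : Bool) :
    DifferentiableAt ℝ (localForm (α i) x₀) y :=
  (((h.smooth_form i).contDiffOn_localForm x₀).contDiffAt
    ((isOpen_target x₀).mem_nhds hy)).differentiableAt (by simp)

theorem differentiableAt_localField (h : IsNormalPair α Z φ d)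
    (hy : y ∈ (extChartAt 𝓘(ℝ, E) x₀).target) (i : Bool) :
    DifferentiableAt ℝ (localField (Z i) x₀) y :=
  (((h.smooth_field i).contDiffOn_localField x₀).contDiffAt
    ((isOpen_target x₀).mem_nhds hy)).differentiableAt (by simp)

theorem differentiableAt_localEnd (h : IsNormalPair α Z φ d)
    (hy : y ∈ (extChartAt 𝓘(ℝ, E) x₀).target) :
    DifferentiableAt ℝ (localEnd φ x₀) y :=
  ((h.smooth_end.contDiffOn_localEnd x₀).contDiffAt
    ((isOpen_target x₀).mem_nhds hy)).differentiableAt (by simp)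

/-- The algebraic identities hold on the whole chart domain, so they may be differentiated at `y`;
this gives `a_dz`, `dφ_z` and `a_dφ`. -/
theorem isContact [FiniteDimensional ℝ E] (h : IsNormalPair α Z φ d)
    (hy : y ∈ (extChartAt 𝓘(ℝ, E) x₀).target) : (localJet α Z φ x₀ y).IsContact where
  sq := h.localEnd_sq hy
  a_z := h.localForm_localField_eq hy
  a_dz i k u := by
    have h1 := (h.differentiableAt_localForm hy i).hasFDerivAt.clm_apply
      (h.differentiableAt_localField hy k).hasFDerivAt
    have h2 := (hasFDerivAt_const (𝕜 := ℝ) (if i = k then (1 : ℝ) else 0) y)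
      |>.congr_of_eventuallyEq (Filter.eventually_of_mem ((isOpen_target x₀).mem_nhds hy)
        fun z hz ↦ h.localForm_localField_eq hz i k)
    have := DFunLike.congr_fun (h1.unique h2) u
    simp only [_root_.add_apply, ContinuousLinearMap.comp_apply, ContinuousLinearMap.flip_apply,
      _root_.zero_apply] at this
    exact eq_neg_of_add_eq_zero_left this
  φ_z := h.localEnd_localField_eq_zero hy
  dφ_z k u := by
    have h1 := (h.differentiableAt_localEnd hy).hasFDerivAt.clm_apply
      (h.differentiableAt_localField hy k).hasFDerivAt
    have h2 := (hasFDerivAt_const (𝕜 := ℝ) (0 : E) y)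
      |>.congr_of_eventuallyEq (Filter.eventually_of_mem ((isOpen_target x₀).mem_nhds hy)
        fun z hz ↦ h.localEnd_localField_eq_zero hz k)
    have := DFunLike.congr_fun (h1.unique h2) u
    simp only [_root_.add_apply, ContinuousLinearMap.comp_apply, ContinuousLinearMap.flip_apply,
      _root_.zero_apply] at this
    exact eq_neg_of_add_eq_zero_right this
  a_φ := h.localForm_localEnd_eq_zero hy
  a_dφ i u v := apply_fderiv_of_apply_eq_zero (h.differentiableAt_localForm hy i)
    (h.differentiableAt_localEnd hy) (Filter.eventually_of_mem ((isOpen_target x₀).mem_nhds hy)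
      fun _ hz v ↦ h.localForm_localEnd_eq_zero hz i v) u v
  da_z i k u := by
    have h1 := extDerivOneForm_chartSymmDeriv (h.smooth_form i) hy (localField (Z k) x₀ y) u
    have h2 : chartSymmDeriv x₀ y (localField (Z k) x₀ y) = Z k _ :=
      chartSymmDeriv_chartDeriv hy (Z k _)
    rw [h2] at h1
    exact (sub_eq_zero.1 (h1.symm.trans (h.contract i k _ _))).symm
  φ_isChar i v hv := by
    rw [isChar_localJet_iff, ← chartSymmDeriv_mem_characteristic (h.smooth_form i) hy] at hv ⊢
    exact (chartSymmDeriv_chartDeriv hy (φ _ (chartSymmDeriv x₀ y v))).symm ▸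
      h.decomposable i _ _ hv
  exists_add v hv₁ hv₂ := by
    have htop := (h.isCompl ((extChartAt 𝓘(ℝ, E) x₀).symm y)).sup_eq_top
    obtain ⟨u₁, hu₁, u₂, hu₂, hu⟩ := Submodule.mem_sup.1
      (htop.symm ▸ Submodule.mem_top : chartSymmDeriv x₀ y v ∈ _)
    have hmem {i : Bool} {u : E}
        (hu : u ∈ characteristic 𝓘(ℝ, E) (α i) ((extChartAt 𝓘(ℝ, E) x₀).symm y)) :
        (localJet α Z φ x₀ y).IsChar i
          (chartDeriv x₀ ((extChartAt 𝓘(ℝ, E) x₀).symm y) u) := by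
      rw [isChar_localJet_iff, ← chartSymmDeriv_mem_characteristic (h.smooth_form i) hy]
      exact (chartSymmDeriv_chartDeriv hy u).symm ▸ hu
    have hadd := (map_add (chartDeriv (E := E) x₀ _) u₁ u₂).symm.trans
      ((congrArg (chartDeriv (E := E) x₀ _) hu).trans (chartDeriv_chartSymmDeriv hy v))
    -- Each component is killed by its own form; as the sum is horizontal, it is killed by the other
    -- form too.
    refine ⟨_, _, hadd, hmem hu₁, hmem hu₂, ?_, ?_⟩
    · have := congrArg ((localJet α Z φ x₀ y).a true) hadd
      rw [map_add, hv₂, (hmem hu₂).1, add_zero] at this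
      exact this
    · have := congrArg ((localJet α Z φ x₀ y).a false) hadd
      rw [map_add, hv₁, (hmem hu₁).1, zero_add] at this
      exact this
  normal_omega i v w hv hw := by
    rw [isChar_localJet_iff] at hv hw
    exact (LeavesAreNormal.local_jets (h.smooth_form i) (h.smooth_form !i) (h.smooth_field i)
      h.smooth_end (h.finrank _) (h.field_mem_characteristic i) (h.decomposable _) (h.form_end i)
      (h.normal i) hy).1 v hv w hw
  normal_lieEnd i v hv := by
    rw [isChar_localJet_iff] at hv
    exact (LeavesAreNormal.local_jets (h.smooth_form i) (h.smooth_form !i) (h.smooth_field i)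
      h.smooth_end (h.finrank _) (h.field_mem_characteristic i) (h.decomposable _) (h.form_end i)
      (h.normal i) hy).2 v hv

theorem differentiableAt_localEnd_cpx (h : IsNormalPair α Z φ d)
    {A : Π x : M, TangentSpace 𝓘(ℝ, E) x →L[ℝ] TangentSpace 𝓘(ℝ, E) x} {ε : ℝ}
    (hA : ∀ p v, A p v = φ p v + ε • (α false p v • Z true p - α true p v • Z false p))
    (hy : y ∈ (extChartAt 𝓘(ℝ, E) x₀).target) : DifferentiableAt ℝ (localEnd A x₀) y := by
  have hsr (i k : Bool) : DifferentiableAt ℝ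
      (fun z ↦ (localForm (α i) x₀ z).smulRight (localField (Z k) x₀ z)) y :=
    ((ContinuousLinearMap.smulRightL ℝ E E).differentiableAt.comp y
      (h.differentiableAt_localForm hy i)).clm_apply (h.differentiableAt_localField hy k)
  rw [funext (localEnd_cpx hA)]
  exact (h.differentiableAt_localEnd hy).add (((hsr false true).sub (hsr true false)).const_smul ε)

theorem isCpxDeriv (h : IsNormalPair α Z φ d)
    {A : Π x : M, TangentSpace 𝓘(ℝ, E) x →L[ℝ] TangentSpace 𝓘(ℝ, E) x} {ε : ℝ}
    (hA : ∀ p v, A p v = φ p v + ε • (α false p v • Z true p - α true p v • Z false p))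
    (hy : y ∈ (extChartAt 𝓘(ℝ, E) x₀).target) :
    (localJet α Z φ x₀ y).IsCpxDeriv ε (fderiv ℝ (localEnd A x₀) y) := by
  intro u v
  have hv := hasFDerivAt_const (𝕜 := ℝ) v y
  have h1 := (h.differentiableAt_localEnd_cpx hA hy).hasFDerivAt.clm_apply hv
  have hf (i k : Bool) := (((h.differentiableAt_localForm hy i).hasFDerivAt.clm_apply hv).smul
    (h.differentiableAt_localField hy k).hasFDerivAt)
  have h2 := ((h.differentiableAt_localEnd hy).hasFDerivAt.clm_apply hv).add
    (((hf false true).sub (hf true false)).const_smul ε)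
  have h3 := h2.congr_of_eventuallyEq (f₁ := fun z ↦ localEnd A x₀ z v)
    (Filter.Eventually.of_forall fun z ↦ DFunLike.congr_fun (localEnd_cpx hA z) v)
  have := DFunLike.congr_fun (h1.unique h3) u
  simp at this
  rw [this]
  change _ = fderiv ℝ (localEnd φ x₀) y u v + ε •
    (fderiv ℝ (localForm (α false) x₀) y u v • localField (Z true) x₀ y
      + localForm (α false) x₀ y v • fderiv ℝ (localField (Z true) x₀) y u
      - fderiv ℝ (localForm (α true) x₀) y u v • localField (Z false) x₀ y
      - localForm (α true) x₀ y v • fderiv ℝ (localField (Z false) x₀) y u)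
  module

/-- Stated for either sign of ε, so that both implications of the theorem are instances. -/
theorem isIntegrable_of_neg [FiniteDimensional ℝ E] [T2Space M] (h : IsNormalPair α Z φ d)
    {A B : Π x : M, TangentSpace 𝓘(ℝ, E) x →L[ℝ] TangentSpace 𝓘(ℝ, E) x} {ε : ℝ}
    (hε : ε = 1 ∨ ε = -1)
    (hA : ∀ p v, A p v = φ p v + ε • (α false p v • Z true p - α true p v • Z false p))
    (hB : ∀ p v, B p v = φ p v + (-ε) • (α false p v • Z true p - α true p v • Z false p))
    (hint : IsIntegrable 𝓘(ℝ, E) A) : IsIntegrable 𝓘(ℝ, E) B := by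
  have ht (x : M) := mem_extChartAt_target (I := 𝓘(ℝ, E)) x
  rw [isIntegrable_iff_nijenhuisJet fun x ↦ h.differentiableAt_localEnd_cpx hA (ht x)] at hint
  rw [isIntegrable_iff_nijenhuisJet fun x ↦ h.differentiableAt_localEnd_cpx hB (ht x)]
  intro x v w
  have hA' := localEnd_cpx (x₀ := x) hA (extChartAt 𝓘(ℝ, E) x x)
  have hB' := localEnd_cpx (x₀ := x) hB (extChartAt 𝓘(ℝ, E) x x)
  rw [hB']
  refine (h.isContact (ht x)).nijenhuisJet_cpx_neg_eq_zero hε (h.isCpxDeriv hA (ht x))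
    (h.isCpxDeriv hB (ht x)) (fun v w ↦ ?_) v w
  have := hint x v w
  rw [hA'] at this
  exact this

end IsNormalPair

end Jet
end ContactPairs

end

/-! ### Assembly of the main theorem. -/

noncomputable section

namespace ContactPairs

section Main

variable {E : Type*} [NormedAddCommGroup E] [NormedSpace ℝ E] [FiniteDimensional ℝ E]
  {M : Type*} [TopologicalSpace M] [ChartedSpace E M] [IsManifold 𝓘(ℝ, E) ∞ M]

theorem IsContactPair.isCompl_characteristic {h k : ℕ}
    {α₁ α₂ : Π x : M, TangentSpace 𝓘(ℝ, E) x →L[ℝ] ℝ}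
    (H : IsContactPair 𝓘(ℝ, E) h k α₁ α₂) (p : M) :
    IsCompl (characteristic 𝓘(ℝ, E) α₁ p) (characteristic 𝓘(ℝ, E) α₂ p) ∧
      Module.finrank ℝ (characteristic 𝓘(ℝ, E) α₁ p) = 2 * k + 1 ∧
      Module.finrank ℝ (characteristic 𝓘(ℝ, E) α₂ p) = 2 * h + 1 := by
  exact isCompl_of_wedge_ne_zero (V := E) H.finrank_eq (H.volume_form p)
    (H.pow₁_eq_zero p) (H.pow₂_eq_zero p) (fun v ↦ Iff.rfl) (fun v ↦ Iff.rfl)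

theorem IsContactPairStructure.isNormalPair {h k : ℕ}
    {α₁ α₂ : Π x : M, TangentSpace 𝓘(ℝ, E) x →L[ℝ] ℝ} {Z₁ Z₂ : Π x : M, TangentSpace 𝓘(ℝ, E) x}
    {φ : Π x : M, TangentSpace 𝓘(ℝ, E) x →L[ℝ] TangentSpace 𝓘(ℝ, E) x}
    (hstr : IsContactPairStructure 𝓘(ℝ, E) h k α₁ α₂ Z₁ Z₂ φ)
    (hdec : IsDecomposable 𝓘(ℝ, E) α₁ α₂ φ)
    (hnormal₂ : LeavesAreNormal 𝓘(ℝ, E) (characteristic 𝓘(ℝ, E) α₂) α₁ Z₁ φ)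
    (hnormal₁ : LeavesAreNormal 𝓘(ℝ, E) (characteristic 𝓘(ℝ, E) α₁) α₂ Z₂ φ) :
    IsNormalPair (fun i ↦ cond i α₂ α₁) (fun i ↦ cond i Z₂ Z₁) φ
      (fun i ↦ cond i (2 * h + 1) (2 * k + 1)) where
  smooth_form
    | false => hstr.contactPair.smooth₁
    | true => hstr.contactPair.smooth₂
  smooth_field
    | false => hstr.reeb.smooth₁
    | true => hstr.reeb.smooth₂
  smooth_end := hstr.smooth
  sq := hstr.sq
  form_field
    | false, false => hstr.reeb.apply₁₁
    | false, true => hstr.reeb.apply₁₂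
    | true, false => hstr.reeb.apply₂₁
    | true, true => hstr.reeb.apply₂₂
  -- The index order is reversed: here the form comes first, while in the Reeb hypotheses the first
  -- subscript is that of the vector field.
  contract
    | false, false => hstr.reeb.contract₁₁
    | false, true => hstr.reeb.contract₂₁
    | true, false => hstr.reeb.contract₁₂
    | true, true => hstr.reeb.contract₂₂
  end_field
    | false => hstr.apply_reeb₁
    | true => hstr.apply_reeb₂
  isCompl p := (hstr.contactPair.isCompl_characteristic p).1
  finrank
    | false => fun p ↦ (hstr.contactPair.isCompl_characteristic p).2.1
    | true => fun p ↦ (hstr.contactPair.isCompl_characteristic p).2.2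
  decomposable
    | false => hdec.1
    | true => hdec.2
  -- The structure of index 1 lives on the leaves of the characteristic foliation of α₂, and
  -- conversely.
  normal
    | false => hnormal₂
    | true => hnormal₁

end Main

end ContactPairs

end

/-- Let `(α₁, α₂, φ)` be a contact pair structure with Reeb vector fields `Z₁`, `Z₂` and
decomposable `φ`. If the structures `(α₁, Z₁, φ)` and `(α₂, Z₂, φ)` induced on the leaves of the
characteristic foliations of `α₂` and of `α₁` are normal, then `J` is integrable if and only if
`T` is integrable. -/
theorem mainTheorem11 {n : ℕ} {M : Type*} [TopologicalSpace M]
    [ChartedSpace (EuclideanSpace ℝ (Fin n)) M] [IsManifold (𝓡 n) ∞ M]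
    [T2Space M] [SecondCountableTopology M]
    (h k : ℕ)
    (α₁ α₂ : Π x : M, TangentSpace (𝓡 n) x →L[ℝ] ℝ)
    (Z₁ Z₂ : Π x : M, TangentSpace (𝓡 n) x)
    (φ : Π x : M, TangentSpace (𝓡 n) x →L[ℝ] TangentSpace (𝓡 n) x)
    (hstr : ContactPairs.IsContactPairStructure (𝓡 n) h k α₁ α₂ Z₁ Z₂ φ)
    (hdec : ContactPairs.IsDecomposable (𝓡 n) α₁ α₂ φ)
    (hnormal₂ : ContactPairs.LeavesAreNormal (𝓡 n)
      (ContactPairs.characteristic (𝓡 n) α₂) α₁ Z₁ φ)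
    (hnormal₁ : ContactPairs.LeavesAreNormal (𝓡 n)
      (ContactPairs.characteristic (𝓡 n) α₁) α₂ Z₂ φ) :
    ContactPairs.IsIntegrable (𝓡 n) (ContactPairs.almostComplexJ (𝓡 n) α₁ α₂ Z₁ Z₂ φ) ↔
      ContactPairs.IsIntegrable (𝓡 n) (ContactPairs.almostComplexT (𝓡 n) α₁ α₂ Z₁ Z₂ φ) := by
  have H := hstr.isNormalPair hdec hnormal₂ hnormal₁
  have hJ (p : M) (v : TangentSpace (𝓡 n) p) :
      ContactPairs.almostComplexJ (𝓡 n) α₁ α₂ Z₁ Z₂ φ p v =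
        φ p v + (1 : ℝ) • (α₁ p v • Z₂ p - α₂ p v • Z₁ p) := by
    change φ p v - α₂ p v • Z₁ p + α₁ p v • Z₂ p = _
    module
  have hT (p : M) (v : TangentSpace (𝓡 n) p) :
      ContactPairs.almostComplexT (𝓡 n) α₁ α₂ Z₁ Z₂ φ p v =
        φ p v + (-1 : ℝ) • (α₁ p v • Z₂ p - α₂ p v • Z₁ p) := by
    change φ p v + α₂ p v • Z₁ p - α₁ p v • Z₂ p = _
    module
  refine ⟨H.isIntegrable_of_neg (Or.inl rfl) hJ hT, H.isIntegrable_of_neg (Or.inr rfl) hT ?_⟩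
  rw [neg_neg]
  exact hJ
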